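/- **Setting.** Let $\nu$ be a probability measure on $\mathbb R$, let $Y$ have law $\nu$, let $\psi:\mathbb R\to\mathbb R_+$ be $L$-Lipschitz and $b:\mathbb R\to\mathbb R_+$ Borel. Let $T>0$, $M\in\mathbb N^*$, $\Delta=T/M$, $h\in L^1([0,T])$ a (pointwise defined) Borel function, and for $t\in[0,T]$ put $n_t=\lfloor t/\Delta\rfloor$ and $(t)_\Delta=n_t\Delta$. Let $P$ be a Poisson random measure on $\mathbb R_+\times\mathbb R_+\times\mathbb R$ with intensity $ds\,d\theta\,\nu(dy)$ on some probability space, and let $\mathcal F_t$ be the $\sigma$-algebra generated by the variables $P(A)$, with $A$ a measurable subset of $(0,t]\times\mathbb R_+\times\mathbb R$. *Continuous-time intensity.* $\lambda$ is an $\mathcal F$-predictable process such that almost surely $P\{(s,\theta,y): s\le T,\ \theta\le\lambda_s\}<\infty$ and, for all $t\in[0,T]$, $$\lambda_t=\psi\Big(\int_{[0,t)\times\mathbb R_+\times\mathbb R}h(t-s)\,\mathbf 1_{\theta\le\lambda_s}\,b(y)\,P(ds,d\theta,dy)\Big).$$ *Discrete-time intensity.* $\lambda^\Delta_t=l_{n_t}$,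 where $l_0=l_1=\psi(0)$ and recursively $$l_n=\psi\Big(\sum_{k=1}^{n-1}h((n-k)\Delta)X_k\Big),\qquad X_n=\int_{((n-1)\Delta,n\Delta]\times\mathbb R_+\times\mathbb R}b(y)\,\mathbf 1_{\theta\le l_n}\,P(ds,d\theta,dy).$$ *Stability assumptions.* $\mathbb E|Y|<\infty$, $\mathbb E[b(Y)]<\infty$, $$\rho_h:=L\int_0^T|h(t)|\,dt\;\mathbb E[b(Y)]<1\qquad\text{and}\qquad \rho_{h,\Delta}:=L\sum_{k=1}^M|h(k\Delta)|\,\Delta\;\mathbb E[b(Y)]<1 .$$ *Constants.* $$C_S(h,\Delta)=\frac1{1-\rho_h}+\frac1{1-\rho_{h,\Delta}},$$ $$C_R(h,\Delta)=\int_0^\Delta|h(y)|\,dy+\sup_{\epsilon\in[0,\Delta]}\int_0^{T-\Delta}|h(y+\epsilon)-h(y)|\,dy+\int_0^{T-\Delta}\big|h(y)-h((y)_\Delta+\Delta)\big|\,dy .$$ **Statement.** For all $L,\psi,\nu,b$ as above and every $\rho_0<1$ there is a constant $K$, depending only on $(L,\psi,\nu,b,\rho_0)$ and in particular not on $T$,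 $M$, $\Delta$ or the probability space, such that, whenever both stability assumptions hold and $\rho_h\le\rho_0$, for every $u\in[0,T]$ the difference $\lambda_{(u)_\Delta}-\lambda^\Delta_u$ is integrable and $$\mathbb E\big|\lambda_{(u)_\Delta}-\lambda^\Delta_u\big|\le K\,C_R(h,\Delta)\,C_S(h,\Delta).$$ -/

import Mathlib

open MeasureTheory ProbabilityTheory
open scoped NNReal ENNReal

universe u

namespace HawkesApprox

noncomputable section

/-! ### Poisson random measures -/

/-- A point measure: an at most countable sum of Dirac masses. -/
def IsPointMeasure {E : Type*} [MeasurableSpace E] (m : Measure E) : Prop :=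
  ∃ (ι : Type) (_ : Countable ι) (x : ι → E), m = Measure.sum fun i => Measure.dirac (x i)

/-- `P` is a Poisson random measure with intensity measure `μ` on the probability space
`(Ω, Pr)`: a random point measure such that `P(A)` has the Poisson law of parameter `μ(A)`
whenever `μ(A)` is finite, and such that `P(A₁), …, P(Aₙ)` are independent whenever
`A₁, …, Aₙ` are pairwise disjoint. -/
structure IsPoissonRandomMeasure {Ω E : Type*} [MeasurableSpace Ω] [MeasurableSpace E]
    (Pr : Measure Ω) (μ : Measure E) (P : Ω → Measure E) : Prop where
  measurable : Measurable P
  isPointMeasure : ∀ ω, IsPointMeasure (P ω)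
  law : ∀ A : Set E, MeasurableSet A → μ A ≠ ∞ →
    Pr.map (fun ω => P ω A) =
      (poissonMeasure (μ A).toNNReal).map (fun n : ℕ => (n : ℝ≥0∞))
  indep : ∀ (n : ℕ) (A : Fin n → Set E), (∀ i, MeasurableSet (A i)) →
    (Pairwise fun i j => Disjoint (A i) (A j)) →
    iIndepFun (fun (i : Fin n) (ω : Ω) => P ω (A i)) Pr

/-- The state space `ℝ₊ × ℝ₊ × ℝ` of the points `(s, θ, y)`: time, level and mark. -/
abbrev Pt : Type := ℝ≥0 × ℝ≥0 × ℝ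

/-- Lebesgue measure on `ℝ₊`. -/
def lebesgueNN : Measure ℝ≥0 :=
  ((volume : Measure ℝ).restrict (Set.Ici 0)).map Real.toNNReal

/-- The intensity measure `ds dθ ν(dy)`. -/
def intensityMeasure (ν : Measure ℝ) : Measure Pt :=
  lebesgueNN.prod (lebesgueNN.prod ν)

/-- The filtration of the random measure `P`: `𝓕 t` is generated by the variables `P(A)`, for
`A` a measurable subset of `(0, t] × ℝ₊ × ℝ`. -/
def naturalFiltration {Ω : Type*} [mΩ : MeasurableSpace Ω] (P : Ω → Measure Pt)
    (hP : Measurable P) : Filtration ℝ≥0 mΩ where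
  seq t := ⨆ A ∈ {A : Set Pt | MeasurableSet A ∧ ∀ p ∈ A, p.1 ∈ Set.Ioc 0 t},
    MeasurableSpace.comap (fun ω => P ω A) inferInstance
  mono' s t hst := by
    refine iSup₂_le fun A hA => ?_
    exact le_iSup₂_of_le A ⟨hA.1, fun p hp => ⟨(hA.2 p hp).1, (hA.2 p hp).2.trans hst⟩⟩ le_rfl
  le' t := by
    refine iSup₂_le fun A hA => ?_
    exact ((Measure.measurable_coe hA.1).comp hP).comap_le

/-! ### The continuous-time intensity -/

/-- `lam` is the intensity on `[0, T]` of the marked Hawkes process with kernel `h`, jump rate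
`ψ` and mark modulation `b`, obtained by thinning from `P`: it is predictable, almost surely the
process `N` accepts only finitely many points `(s, θ, y)` (those with `θ ≤ lam s`) up to time
`T`, and almost surely, for all `t ∈ [0, T]`,
`lam t = ψ (∫_{[0,t) × ℝ₊ × ℝ} h (t - s) 1_{θ ≤ lam s} b y P(ds, dθ, dy))`. -/
structure IsHawkesIntensity {Ω : Type*} [MeasurableSpace Ω] (Pr : Measure Ω)
    (P : Ω → Measure Pt) (hP : Measurable P) (T : ℝ≥0) (h ψ b : ℝ → ℝ)
    (lam : ℝ≥0 → Ω → ℝ) : Prop where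
  predictable : IsStronglyPredictable (naturalFiltration P hP) lam
  nonexplosive : ∀ᵐ ω ∂Pr, P ω {p : Pt | p.1 ≤ T ∧ (p.2.1 : ℝ) ≤ lam p.1 ω} < ∞
  equation : ∀ᵐ ω ∂Pr, ∀ t : ℝ≥0, t ≤ T →
    lam t ω = ψ (∫ p in {p : Pt | p.1 < t ∧ (p.2.1 : ℝ) ≤ lam p.1 ω},
      h ((t : ℝ) - (p.1 : ℝ)) * b p.2.2 ∂(P ω))

/-! ### The discrete-time intensity -/

/-- `X_k = ∫_{((k-1)Δ, kΔ] × ℝ₊ × ℝ} b y 1_{θ ≤ l} m(ds, dθ, dy)` for a level `l` and a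
realisation `m` of the point measure. -/
def binMass (m : Measure Pt) (b : ℝ → ℝ) (Δ : ℝ≥0) (k : ℕ) (l : ℝ) : ℝ :=
  ∫ p in {p : Pt | p.1 ∈ Set.Ioc (((k - 1 : ℕ) : ℝ≥0) * Δ) ((k : ℝ≥0) * Δ) ∧ (p.2.1 : ℝ) ≤ l},
    b p.2.2 ∂m

/-- The discrete intensity `l_n = ψ (∑_{k=1}^{n-1} h ((n-k)Δ) X_k)`, where `X_k` is the mass of
the `k`-th bin below the level `l_k`, for a realisation `m` of the point measure. -/
def discIntensity (m : Measure Pt) (h ψ b : ℝ → ℝ) (Δ : ℝ≥0) (n : ℕ) : ℝ :=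
  ψ (∑ k ∈ (Finset.Ico 1 n).attach,
    h (((n - k.1 : ℕ) : ℝ) * Δ) * binMass m b Δ k.1 (discIntensity m h ψ b Δ k.1))
termination_by n
decreasing_by exact (Finset.mem_Ico.mp k.2).2

theorem discIntensity_eq (m : Measure Pt) (h ψ b : ℝ → ℝ) (Δ : ℝ≥0) (n : ℕ) :
    discIntensity m h ψ b Δ n = ψ (∑ k ∈ Finset.Ico 1 n,
      h (((n - k : ℕ) : ℝ) * Δ) * binMass m b Δ k (discIntensity m h ψ b Δ k)) := by
  rw [discIntensity]
  congr 1
  exact Finset.sum_attach (Finset.Ico 1 n) fun k =>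
    h (((n - k : ℕ) : ℝ) * Δ) * binMass m b Δ k (discIntensity m h ψ b Δ k)

/-- The projection `(t)_Δ = ⌊t / Δ⌋ Δ` on the grid. -/
def gridProj (Δ t : ℝ≥0) : ℝ≥0 := (⌊t / Δ⌋₊ : ℝ≥0) * Δ

/-- The piecewise constant process `λ^Δ_t = l_{n_t}` with `n_t = ⌊t / Δ⌋`. -/
def discLam {Ω : Type*} (P : Ω → Measure Pt) (h ψ b : ℝ → ℝ) (Δ t : ℝ≥0) (ω : Ω) : ℝ :=
  discIntensity (P ω) h ψ b Δ ⌊t / Δ⌋₊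

/-! ### Stability assumptions and constants -/

/-- `ρ_h = L ‖h‖_{L¹([0,T])} E[b(Y)]` with `Y` of law `ν`. -/
def rho (L T : ℝ≥0) (h b : ℝ → ℝ) (ν : Measure ℝ) : ℝ :=
  L * (∫ s in (0 : ℝ)..T, |h s|) * ∫ y, b y ∂ν

/-- `ρ_{h,Δ} = L ∑_{k=1}^M |h(kΔ)| Δ E[b(Y)]`. -/
def rhoDisc (L Δ : ℝ≥0) (M : ℕ) (h b : ℝ → ℝ) (ν : Measure ℝ) : ℝ :=
  L * (∑ k ∈ Finset.Icc 1 M, |h ((k : ℝ) * Δ)| * Δ) * ∫ y, b y ∂ν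

/-- Continuous-time stability: `E[b(Y)]` and `E|Y|` are finite, and `ρ_h < 1`. -/
def Stability (L T : ℝ≥0) (h b : ℝ → ℝ) (ν : Measure ℝ) : Prop :=
  Integrable (fun y : ℝ => y) ν ∧ Integrable b ν ∧ rho L T h b ν < 1

/-- Discrete-time stability: `E[b(Y)]` and `E|Y|` are finite, and `ρ_{h,Δ} < 1`. -/
def StabilityDisc (L Δ : ℝ≥0) (M : ℕ) (h b : ℝ → ℝ) (ν : Measure ℝ) : Prop :=
  Integrable (fun y : ℝ => y) ν ∧ Integrable b ν ∧ rhoDisc L Δ M h b ν < 1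

/-- `C_S(h, Δ)`. -/
def constS (L T Δ : ℝ≥0) (M : ℕ) (h b : ℝ → ℝ) (ν : Measure ℝ) : ℝ :=
  1 / (1 - rho L T h b ν) + 1 / (1 - rhoDisc L Δ M h b ν)

/-- `C_R(h, Δ)`. -/
def constR (T Δ : ℝ≥0) (h : ℝ → ℝ) : ℝ :=
  (∫ y in (0 : ℝ)..Δ, |h y|)
    + (⨆ ε : Set.Icc (0 : ℝ) Δ, ∫ y in (0 : ℝ)..((T : ℝ) - Δ), |h (y + ε) - h y|)
    + ∫ y in (0 : ℝ)..((T : ℝ) - Δ), |h y - h ((⌊y / (Δ : ℝ)⌋₊ : ℝ) * Δ + Δ)|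

end

end HawkesApprox

namespace HawkesApprox

/-! ### Poisson random measures -/

/-! The two intensities are driven by the same points, so they differ for two reasons only: a past
point is weighted by h(t - s) in one and by h((n - k)Δ) in the other, and it is accepted below λ_s
in one and below l_k in the other. Both effects are linear in mean. By the compensation formula
`IsPoissonRandomMeasure.lintegral_predictable`, an expected sum over points with predictable weights
is a Lebesgue integral. Accepted levels then contribute λ_s, and levels accepted by exactly one
thinning contribute |λ_s - l_k|.

The mean intensity satisfies E λ_t ≤ ψ(0) + L E[b(Y)] ∫ |h(t - s)| E λ_s ds, a renewal inequality
with kernel of mass ρ_h < 1. This yields E λ_t ≤ C = ψ(0)/(1 - ρ_h)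
(`IsHawkesIntensity.lintegral_le`), after a localisation that supplies the integrability needed a
priori.

Put Y = L E[b(Y)] C C_R. Changing weights under the fixed threshold λ costs at most Y, both for an
increment of λ over a time at most Δ and for sampling h on the grid; these are the kernel estimates
`lintegral_pastWeight_sub_le` and `lintegral_pastWeight_sub_binWeight_le`. Changing the threshold
costs a sum of the terms L E[b(Y)] |h((n - k)Δ)| Δ times the gap on bin k, and that gap is at most Y
plus the gap at kΔ. Since these coefficients sum to at most r = ρ_{h,Δ} < 1, strong induction in
`IsHawkesIntensity.lintegral_grid_le` bounds every gap by 2Y/(1 - r).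

All estimates are made with integrals in `ℝ≥0∞`, so integrability of the difference is a by-product.
-/

theorem lintegral_natCast_poissonMeasure (r : ℝ≥0) :
    ∫⁻ n : ℕ, (n : ℝ≥0∞) ∂(poissonMeasure r) = r := by
  have h1 : ∑' n : ℕ, ENNReal.ofReal (Real.exp (-r) * r ^ n / n.factorial) = 1 := by
    rw [← ENNReal.ofReal_tsum_of_nonneg (fun n => by positivity)
      (hasSum_one_poissonMeasure r).summable, (hasSum_one_poissonMeasure r).tsum_eq]
    simp
  rw [poissonMeasure, lintegral_sum_measure]
  simp only [lintegral_smul_measure, lintegral_dirac, smul_eq_mul]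
  rw [tsum_eq_zero_add' ENNReal.summable]
  simp only [Nat.cast_zero, mul_zero, zero_add]
  calc _ = ∑' n : ℕ, (r : ℝ≥0∞) * ENNReal.ofReal (Real.exp (-r) * r ^ n / n.factorial) := by
        congr 1; ext n
        rw [← ENNReal.ofReal_coe_nnreal, ← ENNReal.ofReal_natCast (n + 1),
          ← ENNReal.ofReal_mul (by positivity), ← ENNReal.ofReal_mul (by positivity)]
        congr 1
        rw [Nat.factorial_succ]
        push_cast
        field_simp
        ring
    _ = r := by rw [ENNReal.tsum_mul_left, h1, mul_one]

theorem IsPoissonRandomMeasure.lintegral_apply {Ω E : Type*} [MeasurableSpace Ω]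
    [MeasurableSpace E] {Pr : Measure Ω} {μ : Measure E} {P : Ω → Measure E}
    (hP : IsPoissonRandomMeasure Pr μ P) {A : Set E} (hA : MeasurableSet A) (hμ : μ A ≠ ∞) :
    ∫⁻ ω, P ω A ∂Pr = μ A := by
  have h := lintegral_map (μ := Pr) (f := fun x : ℝ≥0∞ => x) measurable_id
    ((Measure.measurable_coe hA).comp hP.measurable)
  simp only [Function.comp_def] at h
  rw [← h, hP.law A hA hμ, lintegral_map (f := fun x : ℝ≥0∞ => x) measurable_id (by fun_prop),
    lintegral_natCast_poissonMeasure, ENNReal.coe_toNNReal hμ]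

/-- A measurable family of measures coincides with an s-finite kernel at all points where
it is finite on each set of a fixed countable cover. -/
theorem exists_isSFiniteKernel_eq {α E : Type*} [MeasurableSpace α] [MeasurableSpace E]
    {Q : α → Measure E} (hQ : Measurable Q) {B : ℕ → Set E} (hB : ∀ n, MeasurableSet (B n))
    (hU : ⋃ n, B n = Set.univ) :
    ∃ κ : Kernel α E, IsSFiniteKernel κ ∧ ∀ a, (∀ n, Q a (B n) < ∞) → κ a = Q a := by
  classical
  have hD := fun n => MeasurableSet.disjointed hB n
  -- Parameters are sorted by the integer part of the mass of each disjointed piece. On the cell (n,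
  -- j) the restricted measure has mass at most j + 1, hence a finite kernel; where all masses are
  -- finite, exactly one j contributes for each n.
  let G : ℕ × ℕ → Set α := fun i => {a | Q a (disjointed B i.1) ∈ Set.Ico (i.2 : ℝ≥0∞) (i.2 + 1)}
  have hG : ∀ i, MeasurableSet (G i) := fun i =>
    ((Measure.measurable_coe (hD i.1)).comp hQ) measurableSet_Ico
  let κ₀ : Kernel α E := ⟨Q, hQ⟩
  let κ : ℕ × ℕ → Kernel α E := fun i => Kernel.piecewise (hG i) (κ₀.restrict (hD i.1)) 0
  have hfin : ∀ i, IsFiniteKernel (κ i) := fun i => by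
    refine ⟨(i.2 + 1 : ℝ≥0∞), by finiteness, fun a => ?_⟩
    rw [Kernel.piecewise_apply]
    split_ifs with ha
    · rw [Kernel.restrict_apply, Measure.restrict_apply_univ]
      exact ha.2.le
    · simp
  refine ⟨Kernel.sum κ, inferInstance, fun a ha => ?_⟩
  have hfa : ∀ n, Q a (disjointed B n) < ∞ := fun n =>
    (measure_mono (disjointed_subset B n)).trans_lt (ha n)
  ext s hs
  rw [Kernel.sum_apply' _ _ hs]
  refine (ENNReal.tsum_prod (f := fun n j => κ (n, j) a s)).trans ?_
  have hQs : Q a s = ∑' n, Q a (s ∩ disjointed B n) := by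
    rw [← measure_iUnion, ← Set.inter_iUnion, iUnion_disjointed, hU, Set.inter_univ]
    · exact fun i j hij => ((disjoint_disjointed B) hij).mono
        Set.inter_subset_right Set.inter_subset_right
    · exact fun i => hs.inter (hD i)
  rw [hQs]
  congr 1; ext n
  obtain ⟨x, hx⟩ : ∃ x : ℝ≥0, Q a (disjointed B n) = x := ⟨_, (ENNReal.coe_toNNReal (hfa n).ne).symm⟩
  have key : ∀ j : ℕ, a ∈ G (n, j) ↔ j = ⌊x⌋₊ := by
    intro j
    simp only [G, Set.mem_ofPred_eq, hx, Set.mem_Ico]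
    rw [eq_comm, Nat.floor_eq_iff (zero_le)]
    norm_cast
  rw [tsum_eq_single ⌊x⌋₊]
  · rw [Kernel.piecewise_apply, if_pos ((key _).2 rfl), Kernel.restrict_apply' _ _ _ hs]
    rfl
  · intro j hj
    rw [Kernel.piecewise_apply, if_neg (fun h => hj ((key _).1 h))]
    simp

/-- The values of a Poisson random measure on finitely many sets are independent of its value on
a set disjoint from them. -/
theorem IsPoissonRandomMeasure.indep_finset {Ω E : Type*} [MeasurableSpace Ω]
    [MeasurableSpace E] {Pr : Measure Ω} {μ : Measure E} {P : Ω → Measure E}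
    (hP : IsPoissonRandomMeasure Pr μ P) {B : Set E} (hB : MeasurableSet B)
    (I : Finset (Set E)) (hI : ∀ A ∈ I, MeasurableSet A ∧ Disjoint A B) :
    Indep (⨆ A ∈ I, MeasurableSpace.comap (fun ω => P ω A) inferInstance)
      (MeasurableSpace.comap (fun ω => P ω B) inferInstance) Pr := by
  classical
  -- Independence is assumed for disjoint sets only, so the members of `I` are cut into the atoms of
  -- the algebra they generate, taken outside `B`; the index `none` stands for `B` itself. Each P(A)
  -- is then a sum of masses of atoms.
  let At : Option (I → Bool) → Set E := fun o => o.elim B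
    fun c => (⋂ A : I, if c A then (A : Set E) else (A : Set E)ᶜ) \ B
  have hAtm : ∀ o, MeasurableSet (At o) := by
    rintro (_ | c)
    · exact hB
    · refine MeasurableSet.diff (MeasurableSet.iInter fun A => ?_) hB
      split_ifs
      · exact (hI A A.2).1
      · exact (hI A A.2).1.compl
  have hmem : ∀ (c : I → Bool) (x : E), x ∈ At (some c) ↔
      (∀ A : I, c A = true ↔ x ∈ (A : Set E)) ∧ x ∉ B := by
    intro c x
    simp only [At, Option.elim, Set.mem_sdiff, Set.mem_iInter]
    refine and_congr_left fun _ => forall_congr' fun A => ?_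
    split_ifs with h <;> simp [h]
  have hdis : Pairwise fun i j => Disjoint (At i) (At j) := by
    have h1 : ∀ c, Disjoint (At none) (At (some c)) := fun c => Set.disjoint_sdiff_right
    rintro (_ | c) (_ | c') hne
    · exact absurd rfl hne
    · exact h1 c'
    · exact (h1 c).symm
    · rw [Set.disjoint_left]
      intro x hx hx'
      refine hne (congrArg some (funext fun A => ?_))
      have h1 := ((hmem c x).1 hx).1 A
      have h2 := ((hmem c' x).1 hx').1 A
      rw [Bool.eq_iff_iff, h1, h2]
  have hind : iIndepFun (fun (o : Option (I → Bool)) ω => P ω (At o)) Pr := by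
    let e := Fintype.equivFin (Option (I → Bool))
    have h := hP.indep _ (fun i => At (e.symm i)) (fun i => hAtm _)
      (fun i j hij => hdis (e.symm.injective.ne hij))
    have h' := h.precomp e.injective
    simpa using h'
  have hmeas : ∀ o, Measurable fun ω => P ω (At o) := fun o =>
    (Measure.measurable_coe (hAtm o)).comp hP.measurable
  have hST : Disjoint (Finset.univ.filter fun o : Option (I → Bool) => o ≠ none) {none} := by
    simp
  have h := hind.indepFun_finset _ _ hST hmeas
  rw [IndepFun_iff_Indep] at h
  refine indep_of_indep_of_le_right (indep_of_indep_of_le_left h ?_) ?_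
  · refine iSup₂_le fun A hA => ?_
    have hsum : (fun ω => P ω A) = fun ω =>
        ∑ c : I → Bool, if c ⟨A, hA⟩ then P ω (At (some c)) else 0 := by
      ext ω
      rw [← Finset.sum_filter, ← measure_biUnion_finset]
      · congr 1
        ext x
        simp only [Finset.mem_filter, Finset.mem_univ, true_and, Set.mem_iUnion, exists_prop]
        constructor
        · intro hx
          refine ⟨fun A' => decide (x ∈ (A' : Set E)), by simpa using hx, (hmem _ _).2 ⟨by simp, ?_⟩⟩
          exact Set.disjoint_left.1 (hI A hA).2 hx
        · rintro ⟨c, hc, hx⟩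
          exact (((hmem c x).1 hx).1 ⟨A, hA⟩).1 hc
      · intro c _ c' _ hcc
        exact hdis (fun h => hcc (Option.some_injective _ h))
      · exact fun c _ => hAtm _
    rw [hsum, ← measurable_iff_comap_le]
    refine Finset.measurable_sum _ fun c _ => ?_
    split_ifs
    · have : (fun ω => P ω (At (some c))) = (fun v : (i : (Finset.univ.filter
          fun o : Option (I → Bool) => o ≠ none)) → ℝ≥0∞ => v ⟨some c, by simp⟩) ∘
          fun ω i => P ω (At i) := rfl
      rw [this]
      exact (measurable_pi_apply _).comp (comap_measurable _)
    · exact measurable_const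
  · rw [← measurable_iff_comap_le]
    have : (fun ω => P ω B) = (fun v : (i : ({none} : Finset (Option (I → Bool)))) → ℝ≥0∞ =>
      v ⟨none, by simp⟩) ∘ fun ω i => P ω (At i) := rfl
    rw [this]
    exact (measurable_pi_apply _).comp (comap_measurable _)

/-- The past σ-algebra is the supremum, directed under union, of those generated by finitely many
sets; `indep_finset` treats each of these, and independence passes to directed suprema. -/
theorem IsPoissonRandomMeasure.indep_naturalFiltration {Ω : Type*} [MeasurableSpace Ω]
    {Pr : Measure Ω} [IsProbabilityMeasure Pr] {μ : Measure Pt} {P : Ω → Measure Pt}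
    (hP : IsPoissonRandomMeasure Pr μ P) (t : ℝ≥0) {B : Set Pt} (hB : MeasurableSet B)
    (hBt : ∀ p ∈ B, t < p.1) :
    Indep (naturalFiltration P hP.measurable t)
      (MeasurableSpace.comap (fun ω => P ω B) inferInstance) Pr := by
  classical
  let 𝒜 : Set (Set Pt) := {A | MeasurableSet A ∧ ∀ p ∈ A, p.1 ∈ Set.Ioc 0 t}
  let m : {I : Finset (Set Pt) // ∀ A ∈ I, A ∈ 𝒜} → MeasurableSpace Ω := fun I =>
    ⨆ A ∈ I.1, MeasurableSpace.comap (fun ω => P ω A) inferInstance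
  have hm : naturalFiltration P hP.measurable t = ⨆ I, m I := by
    apply le_antisymm
    · refine iSup₂_le fun A hA => ?_
      refine le_iSup_of_le ⟨{A}, fun A' h => by rwa [Finset.mem_singleton.1 h]⟩ ?_
      simp [m]
    · refine iSup_le fun I => iSup₂_le fun A hA => ?_
      exact le_iSup₂_of_le (f := fun A (_ : A ∈ 𝒜) =>
        MeasurableSpace.comap (fun ω => P ω A) inferInstance) A (I.2 A hA) le_rfl
  have hle : ∀ A, MeasurableSet A →
      MeasurableSpace.comap (fun ω => P ω A) inferInstance ≤ ‹MeasurableSpace Ω› := fun A hA =>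
    ((Measure.measurable_coe hA).comp hP.measurable).comap_le
  rw [hm]
  refine indep_iSup_of_directed_le (fun I => ?_) (fun I => ?_) (hle B hB) ?_
  · refine hP.indep_finset hB I.1 fun A hA => ⟨(I.2 A hA).1, ?_⟩
    rw [Set.disjoint_left]
    exact fun p hp hpB => absurd ((I.2 A hA).2 p hp).2 (not_le.2 (hBt p hpB))
  · exact iSup₂_le fun A hA => hle A (I.2 A hA).1
  · intro I J
    refine ⟨⟨I.1 ∪ J.1, fun A hA => ?_⟩, ?_, ?_⟩
    · rcases Finset.mem_union.1 hA with h | h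
      exacts [I.2 A h, J.2 A h]
    · exact biSup_mono fun A hA => Finset.mem_union_left _ hA
    · exact biSup_mono fun A hA => Finset.mem_union_right _ hA

/-! ### The intensity measure -/

theorem lintegral_lebesgueNN {f : ℝ≥0 → ℝ≥0∞} (hf : Measurable f) :
    ∫⁻ s, f s ∂lebesgueNN = ∫⁻ x in Set.Ici (0 : ℝ), f x.toNNReal :=
  lintegral_map hf measurable_real_toNNReal

theorem lintegral_lebesgueNN_coe {f : ℝ → ℝ≥0∞} (hf : Measurable f) :
    ∫⁻ s : ℝ≥0, f s ∂lebesgueNN = ∫⁻ x in Set.Ici (0 : ℝ), f x := by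
  rw [lintegral_lebesgueNN (f := fun s : ℝ≥0 => f s) (hf.comp measurable_coe_nnreal_real)]
  refine setLIntegral_congr_fun measurableSet_Ici fun x hx => ?_
  simp [Real.coe_toNNReal x hx]

instance : SFinite lebesgueNN := by unfold lebesgueNN; infer_instance

theorem lebesgueNN_apply {A : Set ℝ≥0} (hA : MeasurableSet A) :
    lebesgueNN A = volume (Real.toNNReal ⁻¹' A ∩ Set.Ici 0) := by
  rw [lebesgueNN, Measure.map_apply measurable_real_toNNReal hA,
    Measure.restrict_apply (measurable_real_toNNReal hA)]

theorem lebesgueNN_Iic (a : ℝ≥0) : lebesgueNN (Set.Iic a) = a := by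
  rw [lebesgueNN_apply measurableSet_Iic]
  have : Real.toNNReal ⁻¹' Set.Iic a ∩ Set.Ici 0 = Set.Icc 0 (a : ℝ) := by
    ext x
    simp only [Set.mem_inter_iff, Set.mem_preimage, Set.mem_Iic, Set.mem_Ici, Set.mem_Icc,
      Real.toNNReal_le_iff_le_coe]
    tauto
  rw [this]; simp

theorem lebesgueNN_singleton (a : ℝ≥0) : lebesgueNN {a} = 0 := by
  rw [lebesgueNN_apply (measurableSet_singleton a)]
  refine measure_mono_null (t := {(a : ℝ)}) ?_ (by simp)
  rintro x ⟨hx, hx0⟩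
  rw [Set.mem_preimage, Set.mem_singleton_iff] at hx
  rw [← hx, Set.mem_singleton_iff, Real.coe_toNNReal x hx0]

/-- The points with time and level at most `n`. -/
def box (n : ℕ) : Set Pt := Set.Iic (n : ℝ≥0) ×ˢ (Set.Iic (n : ℝ≥0) ×ˢ Set.univ)

theorem measurableSet_box (n : ℕ) : MeasurableSet (box n) :=
  measurableSet_Iic.prod (measurableSet_Iic.prod MeasurableSet.univ)

theorem monotone_box : Monotone box := fun m n hmn p hp =>
  have h : (m : ℝ≥0) ≤ n := by exact_mod_cast hmn
  ⟨Set.Iic_subset_Iic.2 h hp.1, Set.Iic_subset_Iic.2 h hp.2.1, trivial⟩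

theorem iUnion_box : ⋃ n, box n = Set.univ := by
  refine Set.eq_univ_of_forall fun p => Set.mem_iUnion.2 ?_
  obtain ⟨n, hn⟩ := exists_nat_ge (max p.1 p.2.1)
  exact ⟨n, (le_max_left _ _).trans hn, (le_max_right _ _).trans hn, trivial⟩

theorem intensityMeasure_box_ne_top (ν : Measure ℝ) [IsProbabilityMeasure ν] (n : ℕ) :
    intensityMeasure ν (box n) ≠ ∞ := by
  rw [intensityMeasure, box, Measure.prod_prod, Measure.prod_prod, lebesgueNN_Iic]
  simp [ENNReal.mul_eq_top]

instance (ν : Measure ℝ) [IsProbabilityMeasure ν] : SFinite (intensityMeasure ν) := by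
  unfold intensityMeasure; infer_instance

/-! ### Predictable integrands -/

/-- The `σ`-algebra of predictable integrands depending on the level and the mark. -/
@[reducible] def markedPredictable {Ω : Type*} {m : MeasurableSpace Ω} (F : Filtration ℝ≥0 m) :
    MeasurableSpace ((ℝ≥0 × Ω) × (ℝ≥0 × ℝ)) :=
  @Prod.instMeasurableSpace _ _ F.predictable _

/-- Regrouping of the coordinates. -/
def regroup {Ω : Type*} (x : Ω × Pt) : (ℝ≥0 × Ω) × (ℝ≥0 × ℝ) := ((x.2.1, x.1), x.2.2)

theorem predictable_le {Ω : Type*} {m : MeasurableSpace Ω} (F : Filtration ℝ≥0 m) :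
    F.predictable ≤ Prod.instMeasurableSpace :=
  measurableSpace_le_predictable_of_measurableSet
    (fun A hA => (measurableSet_singleton _).prod (F.le _ A hA))
    (fun i A hA => measurableSet_Ioi.prod (F.le i A hA))

theorem markedPredictable_le {Ω : Type*} {m : MeasurableSpace Ω} (F : Filtration ℝ≥0 m) :
    markedPredictable F ≤ Prod.instMeasurableSpace :=
  sup_le_sup_right (MeasurableSpace.comap_mono (predictable_le F)) _

theorem measurable_regroup {Ω : Type*} {m : MeasurableSpace Ω} :
    Measurable (regroup : Ω × Pt → _) := by
  unfold regroup; fun_prop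

/-- Mixed intersections are empty, and two half-lines meet in the later one, by which time both
events are known. Hence finite measures on the predictable σ-algebra can be compared on these
rectangles. -/
theorem isPiSystem_predictable {Ω : Type*} {m : MeasurableSpace Ω} (F : Filtration ℝ≥0 m) :
    IsPiSystem ({s | ∃ A, MeasurableSet[F ⊥] A ∧ s = {⊥} ×ˢ A} ∪
      {s | ∃ i A, MeasurableSet[F i] A ∧ s = Set.Ioi i ×ˢ A}) := by
  rintro _ (⟨A, hA, rfl⟩ | ⟨i, A, hA, rfl⟩) _ (⟨A', hA', rfl⟩ | ⟨j, A', hA', rfl⟩) -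
  · exact Or.inl ⟨A ∩ A', hA.inter hA', by rw [Set.prod_inter_prod, Set.inter_self]⟩
  · refine Or.inl ⟨∅, @MeasurableSet.empty _ (F ⊥), ?_⟩
    rw [Set.prod_inter_prod, Set.prod_empty]
    simp
  · refine Or.inl ⟨∅, @MeasurableSet.empty _ (F ⊥), ?_⟩
    rw [Set.prod_inter_prod, Set.prod_empty]
    simp
  · refine Or.inr ⟨max i j, A ∩ A', ?_, by rw [Set.prod_inter_prod, Set.Ioi_inter_Ioi]⟩
    exact (F.mono (le_max_left i j) A hA).inter (F.mono (le_max_right i j) A' hA')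

section Compensation

variable {Ω : Type*} [mΩ : MeasurableSpace Ω] {Pr : Measure Ω} [IsProbabilityMeasure Pr]
  {ν : Measure ℝ} [IsProbabilityMeasure ν] {P : Ω → Measure Pt}

omit [IsProbabilityMeasure Pr] in
theorem IsPoissonRandomMeasure.ae_box_lt_top
    (hP : IsPoissonRandomMeasure Pr (intensityMeasure ν) P) :
    ∀ᵐ ω ∂Pr, ∀ n, P ω (box n) < ∞ := by
  refine ae_all_iff.2 fun n => ae_lt_top
    ((Measure.measurable_coe (measurableSet_box n)).comp hP.measurable) ?_
  rw [hP.lintegral_apply (measurableSet_box n) (intensityMeasure_box_ne_top ν n)]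
  exact intensityMeasure_box_ne_top ν n

omit [IsProbabilityMeasure Pr] in
-- An s-finite version of `P` gives access to composition products and to measurability of ω ↦ ∫
-- H(ω, p) P(ω, dp).
theorem IsPoissonRandomMeasure.exists_kernel
    (hP : IsPoissonRandomMeasure Pr (intensityMeasure ν) P) :
    ∃ κ : Kernel Ω Pt, IsSFiniteKernel κ ∧ ∀ᵐ ω ∂Pr, κ ω = P ω := by
  obtain ⟨κ, hκ, h⟩ := exists_isSFiniteKernel_eq hP.measurable measurableSet_box iUnion_box
  exact ⟨κ, hκ, hP.ae_box_lt_top.mono fun ω hω => h ω hω⟩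

omit [IsProbabilityMeasure Pr] in
theorem IsPoissonRandomMeasure.aemeasurable_lintegral
    (hP : IsPoissonRandomMeasure Pr (intensityMeasure ν) P) {H : Ω → Pt → ℝ≥0∞}
    (hH : Measurable (Function.uncurry H)) :
    AEMeasurable (fun ω => ∫⁻ p, H ω p ∂P ω) Pr := by
  obtain ⟨κ, hκ, h⟩ := hP.exists_kernel
  exact ⟨_, hH.lintegral_kernel_prod_right (κ := κ), h.mono fun ω hω => by simp only [hω]⟩

omit [IsProbabilityMeasure ν] in
-- This is the compensation formula on a generator: what is known at time t is independent of the
-- points strictly after t.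
theorem IsPoissonRandomMeasure.lintegral_indicator_mul
    (hP : IsPoissonRandomMeasure Pr (intensityMeasure ν) P) {t : ℝ≥0} {A : Set Ω}
    (hA : MeasurableSet[naturalFiltration P hP.measurable t] A) {B : Set Pt}
    (hB : MeasurableSet B) (hBt : ∀ p ∈ B, t < p.1) (hμ : intensityMeasure ν B ≠ ∞) :
    ∫⁻ ω in A, P ω B ∂Pr = Pr A * intensityMeasure ν B := by
  have hle := (naturalFiltration P hP.measurable).le t
  have hPB := (Measure.measurable_coe hB).comp hP.measurable
  have h := lintegral_mul_eq_lintegral_mul_lintegral_of_independent_measurableSpace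
    (f := A.indicator fun _ => 1) (g := fun ω => P ω B) hle hPB.comap_le
    (hP.indep_naturalFiltration t hB hBt) ((@measurable_const _ _ _ (naturalFiltration P hP.measurable t) 1).indicator hA)
    (comap_measurable _)
  rw [lintegral_indicator_const (hle A hA), one_mul, hP.lintegral_apply hB hμ] at h
  rw [← h, ← lintegral_indicator (hle A hA)]
  congr 1; ext ω
  by_cases hω : ω ∈ A <;> simp [hω]

/-- Compensation formula: predictable integrands have the same expected integral against a
Poisson random measure and against its intensity. -/
theorem IsPoissonRandomMeasure.lintegral_predictable
    (hP : IsPoissonRandomMeasure Pr (intensityMeasure ν) P)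
    {H : (ℝ≥0 × Ω) × (ℝ≥0 × ℝ) → ℝ≥0∞}
    (hH : Measurable[markedPredictable (naturalFiltration P hP.measurable)] H) :
    ∫⁻ ω, ∫⁻ p, H ((p.1, ω), p.2) ∂P ω ∂Pr =
      ∫⁻ p, ∫⁻ ω, H ((p.1, ω), p.2) ∂Pr ∂intensityMeasure ν := by
  obtain ⟨κ, hκ, hκP⟩ := hP.exists_kernel
  set F := naturalFiltration P hP.measurable with hF
  have hH' : Measurable H := hH.mono (markedPredictable_le F) le_rfl
  have hφ : @Measurable _ _ _ (markedPredictable F) (regroup : Ω × Pt → _) :=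
    measurable_regroup.mono le_rfl (markedPredictable_le F)
  -- Both sides are integrals over Ω × `Pt`. The two measures need only agree on the marked
  -- predictable σ-algebra, so they are pushed forward to that coarser σ-algebra, and restricted to
  -- boxes to make them finite for the π-λ argument.
  let M₁ := Pr ⊗ₘ κ
  let M₂ := Pr.prod (intensityMeasure ν)
  have hM₁ : ∀ (A : Set Ω) (B : Set Pt), MeasurableSet A → MeasurableSet B →
      M₁ (A ×ˢ B) = ∫⁻ ω in A, P ω B ∂Pr := fun A B hA hB => by
    rw [Measure.compProd_apply_prod hA hB]
    exact setLIntegral_congr_fun_ae hA (hκP.mono fun ω hω _ => by rw [hω])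
  have hbox : ∀ n, @Measure.map _ _ _ (markedPredictable F) regroup
      (M₁.restrict (Set.univ ×ˢ box n)) = @Measure.map _ _ _ (markedPredictable F) regroup
      (M₂.restrict (Set.univ ×ˢ box n)) := by
    intro n
    have hU : MeasurableSet ((Set.univ : Set Ω) ×ˢ box n) :=
      MeasurableSet.univ.prod (measurableSet_box n)
    have hfin : IsFiniteMeasure (M₁.restrict (Set.univ ×ˢ box n)) := by
      refine ⟨?_⟩
      rw [Measure.restrict_apply_univ, hM₁ _ _ MeasurableSet.univ (measurableSet_box n),
        Measure.restrict_univ,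
        hP.lintegral_apply (measurableSet_box n) (intensityMeasure_box_ne_top ν n)]
      exact (intensityMeasure_box_ne_top ν n).lt_top
    have hrect : ∀ (I : Set ℝ≥0) (A : Set Ω) (D : Set (ℝ≥0 × ℝ)),
        regroup ⁻¹' ((I ×ˢ A) ×ˢ D) ∩ (Set.univ ×ˢ box n) = A ×ˢ ((I ×ˢ D) ∩ box n) := by
      intro I A D
      ext ⟨ω, p⟩
      simp only [regroup, Set.mem_inter_iff, Set.mem_preimage, Set.mem_prod, Set.mem_univ]
      tauto
    have hlt : ∀ B : Set Pt, intensityMeasure ν (B ∩ box n) ≠ ∞ := fun B =>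
      measure_ne_top_of_subset Set.inter_subset_right (intensityMeasure_box_ne_top ν n)
    -- Time 0 carries no mass, so the generators over {0} are null for both measures and
    -- independence is needed only for half-lines.
    have hzero : intensityMeasure ν ({⊥} ×ˢ Set.univ) = 0 := by
      rw [intensityMeasure, Measure.prod_prod, lebesgueNN_singleton, zero_mul]
    refine @Measure.ext_prod (ℝ≥0 × Ω) (ℝ≥0 × ℝ) F.predictable _ _ _ ?_ ?_
    · exact @Measure.isFiniteMeasure_map _ _ (markedPredictable F) _ _ hfin _
    intro S D hS hD
    induction S, hS using MeasurableSpace.induction_on_inter rfl (isPiSystem_predictable F) with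
    | empty => simp
    | basic S hS =>
      have hS' : MeasurableSet[F.predictable] S := MeasurableSpace.measurableSet_generateFrom hS
      have hSD : MeasurableSet[markedPredictable F] (S ×ˢ D) :=
        @MeasurableSet.prod _ _ F.predictable _ _ _ hS' hD
      rw [@Measure.map_apply _ _ _ (markedPredictable F) _ _ hφ _ hSD,
        @Measure.map_apply _ _ _ (markedPredictable F) _ _ hφ _ hSD,
        Measure.restrict_apply (hφ hSD), Measure.restrict_apply (hφ hSD)]
      rcases hS with ⟨A, hA, rfl⟩ | ⟨i, A, hA, rfl⟩
      · have hB := ((measurableSet_singleton (⊥ : ℝ≥0)).prod hD).inter (measurableSet_box n)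
        have h0 : intensityMeasure ν (({⊥} ×ˢ D) ∩ box n) = 0 :=
          measure_mono_null (Set.inter_subset_left.trans
            (Set.prod_mono le_rfl (Set.subset_univ _))) hzero
        rw [hrect, hM₁ _ _ (F.le _ A hA) hB, Measure.prod_prod, h0, mul_zero]
        refine le_antisymm ((setLIntegral_le_lintegral _ _).trans ?_) zero_le
        rw [hP.lintegral_apply hB (hlt _), h0]
      · have hB := ((measurableSet_Ioi (a := i)).prod hD).inter (measurableSet_box n)
        rw [hrect, hM₁ _ _ (F.le _ A hA) hB, Measure.prod_prod,
          hP.lintegral_indicator_mul hA hB (fun p hp => hp.1.1) (hlt _)]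
    | compl S hS ih =>
      have hSD : ∀ S', MeasurableSet[F.predictable] S' →
          MeasurableSet[markedPredictable F] (S' ×ˢ D) := fun S' hS' =>
        @MeasurableSet.prod _ _ F.predictable _ _ _ hS' hD
      have hun : @Measure.map _ _ _ (markedPredictable F) regroup
          (M₁.restrict (Set.univ ×ˢ box n)) (Set.univ ×ˢ D) =
          @Measure.map _ _ _ (markedPredictable F) regroup
          (M₂.restrict (Set.univ ×ˢ box n)) (Set.univ ×ˢ D) := by
        have hu := hSD Set.univ (@MeasurableSet.univ _ F.predictable)
        have hB := ((MeasurableSet.univ (α := ℝ≥0)).prod hD).inter (measurableSet_box n)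
        rw [@Measure.map_apply _ _ _ (markedPredictable F) _ _ hφ _ hu,
          @Measure.map_apply _ _ _ (markedPredictable F) _ _ hφ _ hu,
          Measure.restrict_apply (hφ hu), Measure.restrict_apply (hφ hu), ← Set.univ_prod_univ,
          hrect, hM₁ _ _ MeasurableSet.univ hB, Measure.prod_prod, Measure.restrict_univ,
          hP.lintegral_apply hB (hlt _), measure_univ, one_mul]
      have hdiff : Sᶜ ×ˢ D = (Set.univ ×ˢ D) \ (S ×ˢ D) := by
        ext x; simp only [Set.mem_prod, Set.mem_compl_iff, Set.mem_sdiff, Set.mem_univ]; tauto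
      have hsub : S ×ˢ D ⊆ Set.univ ×ˢ D := Set.prod_mono (Set.subset_univ _) le_rfl
      have hne : @Measure.map _ _ _ (markedPredictable F) regroup
          (M₁.restrict (Set.univ ×ˢ box n)) (S ×ˢ D) ≠ ∞ :=
        @measure_ne_top _ (markedPredictable F) _
          (@Measure.isFiniteMeasure_map _ _ (markedPredictable F) _ _ hfin _) _
      rw [hdiff, @measure_sdiff _ (markedPredictable F) _ _ _ hsub
          (@MeasurableSet.nullMeasurableSet _ (markedPredictable F) _ _ (hSD S hS)) hne,
        @measure_sdiff _ (markedPredictable F) _ _ _ hsub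
          (@MeasurableSet.nullMeasurableSet _ (markedPredictable F) _ _ (hSD S hS)) (ih ▸ hne),
        hun, ih]
    | iUnion f hd hf ih =>
      have hSD : ∀ i, MeasurableSet[markedPredictable F] (f i ×ˢ D) := fun i =>
        @MeasurableSet.prod _ _ F.predictable _ _ _ (hf i) hD
      have hd' : Pairwise fun i j => Disjoint (f i ×ˢ D) (f j ×ˢ D) := fun i j hij =>
        Set.disjoint_prod.2 (Or.inl (hd hij))
      rw [Set.iUnion_prod_const, @measure_iUnion _ _ (markedPredictable F) _ _ _ hd' hSD,
        @measure_iUnion _ _ (markedPredictable F) _ _ _ hd' hSD]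
      exact tsum_congr ih
  have hset : ∀ n, ∫⁻ x in Set.univ ×ˢ box n, H (regroup x) ∂M₁ =
      ∫⁻ x in Set.univ ×ˢ box n, H (regroup x) ∂M₂ := fun n => by
    rw [← @lintegral_map _ _ _ (markedPredictable F) _ _ _ hH hφ, hbox n,
      @lintegral_map _ _ _ (markedPredictable F) _ _ _ hH hφ]
  have hlim : ∀ M : Measure (Ω × Pt), ∫⁻ x, H (regroup x) ∂M =
      ⨆ n, ∫⁻ x in Set.univ ×ˢ box n, H (regroup x) ∂M := fun M => by
    rw [← setLIntegral_iUnion_of_directed, ← Set.prod_iUnion, iUnion_box, Set.univ_prod_univ,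
      Measure.restrict_univ]
    exact (show Monotone fun n => (Set.univ : Set Ω) ×ˢ box n from fun i j hij =>
      Set.prod_mono le_rfl (monotone_box hij)).directed_le
  have hHr : Measurable fun x : Ω × Pt => H (regroup x) := hH'.comp measurable_regroup
  calc ∫⁻ ω, ∫⁻ p, H ((p.1, ω), p.2) ∂P ω ∂Pr
      = ∫⁻ ω, ∫⁻ p, H (regroup (ω, p)) ∂κ ω ∂Pr :=
        lintegral_congr_ae (hκP.mono fun ω hω => by simp only [hω, regroup])
    _ = ∫⁻ x, H (regroup x) ∂M₁ := (Measure.lintegral_compProd hHr).symm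
    _ = ∫⁻ x, H (regroup x) ∂M₂ := by rw [hlim, hlim, iSup_congr hset]
    _ = _ := lintegral_prod_symm _ hHr.aemeasurable

end Compensation

/-! ### Thinned integrals -/

/-- The indicator of `θ ≤ l`. -/
noncomputable def below (l : ℝ) (θ : ℝ≥0) : ℝ≥0∞ := if (θ : ℝ) ≤ l then 1 else 0

/-- The indicator of the levels which lie below exactly one of `l` and `l'`. -/
noncomputable def between (l l' : ℝ) (θ : ℝ≥0) : ℝ≥0∞ :=
  if ((θ : ℝ) ≤ l ∧ l' < θ) ∨ (θ : ℝ) ≤ l' ∧ l < θ then 1 else 0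

theorem measurable_below {X : Type*} [MeasurableSpace X] {l : X → ℝ} {θ : X → ℝ≥0}
    (hl : Measurable l) (hθ : Measurable θ) : Measurable fun x => below (l x) (θ x) :=
  Measurable.ite (measurableSet_le hθ.coe_nnreal_real hl) measurable_const measurable_const

theorem measurable_between {X : Type*} [MeasurableSpace X] {l l' : X → ℝ} {θ : X → ℝ≥0}
    (hl : Measurable l) (hl' : Measurable l') (hθ : Measurable θ) :
    Measurable fun x => between (l x) (l' x) (θ x) := by
  have hθ' := hθ.coe_nnreal_real
  exact Measurable.ite (((measurableSet_le hθ' hl).inter (measurableSet_lt hl' hθ')).union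
    ((measurableSet_le hθ' hl').inter (measurableSet_lt hl hθ'))) measurable_const measurable_const

theorem lebesgueNN_preimage_coe_le (S : Set ℝ) (hS : MeasurableSet S) :
    lebesgueNN {θ | (θ : ℝ) ∈ S} = volume (S ∩ Set.Ici 0) := by
  refine (lebesgueNN_apply (measurable_coe_nnreal_real hS)).trans ?_
  congr 1
  ext x
  simp only [Set.mem_inter_iff, Set.mem_preimage, Set.mem_Ici]
  refine and_congr_left fun hx => ?_
  rw [Real.coe_toNNReal x hx]

theorem lintegral_below_le (l : ℝ) : ∫⁻ θ, below l θ ∂lebesgueNN ≤ ENNReal.ofReal l := by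
  have hm : MeasurableSet {θ : ℝ≥0 | (θ : ℝ) ∈ Set.Iic l} :=
    measurable_coe_nnreal_real measurableSet_Iic
  have : below l = Set.indicator {θ : ℝ≥0 | (θ : ℝ) ∈ Set.Iic l} 1 := by
    ext θ; simp [below, Set.indicator_apply]
  rw [this, lintegral_indicator_one hm, lebesgueNN_preimage_coe_le _ measurableSet_Iic,
    Set.inter_comm, Set.Ici_inter_Iic, Real.volume_Icc, sub_zero]

/-- The separating levels lie in the interval with end points l and l'. A discrepancy between two
thinnings is thus linear in the distance of the thresholds, which is what closes the L¹ estimates.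
-/
theorem lintegral_between_le (l l' : ℝ) :
    ∫⁻ θ, between l l' θ ∂lebesgueNN ≤ ENNReal.ofReal |l - l'| := by
  have hm : MeasurableSet {θ : ℝ≥0 | (θ : ℝ) ∈ Set.uIcc l l'} :=
    measurable_coe_nnreal_real measurableSet_uIcc
  calc ∫⁻ θ, between l l' θ ∂lebesgueNN
      ≤ ∫⁻ θ, Set.indicator {θ : ℝ≥0 | (θ : ℝ) ∈ Set.uIcc l l'} 1 θ ∂lebesgueNN := by
        refine lintegral_mono fun θ => ?_
        rw [between]
        split_ifs with h
        · rw [Set.indicator_of_mem]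
          · rfl
          · rw [Set.mem_ofPred_eq, Set.mem_uIcc]
            rcases h with h | h
            exacts [Or.inr ⟨h.2.le, h.1⟩, Or.inl ⟨h.2.le, h.1⟩]
        · exact zero_le
    _ = volume (Set.uIcc l l' ∩ Set.Ici 0) := by
        rw [lintegral_indicator_one hm, lebesgueNN_preimage_coe_le _ measurableSet_uIcc]
    _ ≤ volume (Set.uIcc l l') := measure_mono Set.inter_subset_left
    _ = ENNReal.ofReal |l - l'| := by rw [Set.uIcc, Real.volume_Icc, max_sub_min_eq_abs, abs_sub_comm]

/-- Expected mark mass of `ν`. -/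
noncomputable def meanMark (ν : Measure ℝ) (b : ℝ → ℝ) : ℝ≥0∞ := ∫⁻ y, ENNReal.ofReal (b y) ∂ν

theorem measurable_marked {X : Type*} [MeasurableSpace X] {w : X → ℝ≥0∞} {d : X → ℝ≥0 → ℝ≥0∞}
    {b : ℝ → ℝ} (hw : Measurable w) (hd : Measurable (Function.uncurry d)) (hb : Measurable b) :
    Measurable fun x : X × (ℝ≥0 × ℝ) => w x.1 * d x.1 x.2.1 * ENNReal.ofReal (b x.2.2) := by
  have : Measurable fun x : X × (ℝ≥0 × ℝ) => Function.uncurry d (x.1, x.2.1) := by fun_prop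
  have h' : Measurable fun x : X × (ℝ≥0 × ℝ) => d x.1 x.2.1 := this
  fun_prop

section Thinning

variable {Ω : Type*} [mΩ : MeasurableSpace Ω] {Pr : Measure Ω} [IsProbabilityMeasure Pr]
  {ν : Measure ℝ} [IsProbabilityMeasure ν] {P : Ω → Measure Pt} {b : ℝ → ℝ}

/-- After compensation, Fubini at fixed time and scenario separates the level from the mark: the
mark yields `meanMark` and the level at most `q`. It serves for `d` equal to `below` and to
`between`. -/
theorem IsPoissonRandomMeasure.lintegral_marked_le
    (hP : IsPoissonRandomMeasure Pr (intensityMeasure ν) P) (hb : Measurable b)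
    {w q : ℝ≥0 × Ω → ℝ≥0∞} {d : ℝ≥0 × Ω → ℝ≥0 → ℝ≥0∞}
    (hw : Measurable[(naturalFiltration P hP.measurable).predictable] w)
    (hd : Measurable[@Prod.instMeasurableSpace _ _
      (naturalFiltration P hP.measurable).predictable _] (Function.uncurry d))
    (hq : ∀ x, ∫⁻ θ, d x θ ∂lebesgueNN ≤ q x) :
    ∫⁻ ω, ∫⁻ p, w (p.1, ω) * d (p.1, ω) p.2.1 * ENNReal.ofReal (b p.2.2) ∂P ω ∂Pr ≤
      meanMark ν b * ∫⁻ s, ∫⁻ ω, w (s, ω) * q (s, ω) ∂Pr ∂lebesgueNN := by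
  have hH := @measurable_marked _ (naturalFiltration P hP.measurable).predictable _ _ _ hw hd hb
  have hH' := hH.mono (markedPredictable_le _) le_rfl
  have hd' : Measurable (Function.uncurry d) := hd.mono
    (sup_le_sup_right (MeasurableSpace.comap_mono (predictable_le _)) _) le_rfl
  rw [hP.lintegral_predictable hH, intensityMeasure, lintegral_prod]
  swap
  · have : Measurable fun z : Pt × Ω => w (z.1.1, z.2) * d (z.1.1, z.2) z.1.2.1 *
      ENNReal.ofReal (b z.1.2.2) :=
      hH'.comp (g := _) (f := fun z : Pt × Ω => ((z.1.1, z.2), z.1.2)) (by fun_prop)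
    exact this.lintegral_prod_right'.aemeasurable
  have hw' : Measurable w := hw.mono (predictable_le _) le_rfl
  have hQ : Measurable fun x => ∫⁻ θ, d x θ ∂lebesgueNN := hd'.lintegral_prod_right'
  have hWQ : Measurable fun x : ℝ≥0 × Ω => w x * ∫⁻ θ, d x θ ∂lebesgueNN := hw'.mul hQ
  calc _ = ∫⁻ s, ∫⁻ ω, ∫⁻ z, w (s, ω) * d (s, ω) z.1 * ENNReal.ofReal (b z.2)
        ∂(lebesgueNN.prod ν) ∂Pr ∂lebesgueNN := by
        refine lintegral_congr fun s => lintegral_lintegral_swap ?_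
        exact (hH'.comp (g := _) (f := fun z : (ℝ≥0 × ℝ) × Ω => ((s, z.2), z.1))
          (by fun_prop)).aemeasurable
    _ = ∫⁻ s, ∫⁻ ω, meanMark ν b * (w (s, ω) * ∫⁻ θ, d (s, ω) θ ∂lebesgueNN) ∂Pr ∂lebesgueNN := by
        refine lintegral_congr fun s => lintegral_congr fun ω => ?_
        have hd1 : Measurable (d (s, ω)) := hd'.comp measurable_prodMk_left
        have hdx : Measurable fun θ => w (s, ω) * d (s, ω) θ := hd1.const_mul _
        rw [lintegral_prod_mul (f := fun θ => w (s, ω) * d (s, ω) θ) hdx.aemeasurable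
          hb.ennreal_ofReal.aemeasurable, lintegral_const_mul _ hd1,
          mul_comm]
        rfl
    _ = meanMark ν b * ∫⁻ s, ∫⁻ ω, w (s, ω) * ∫⁻ θ, d (s, ω) θ ∂lebesgueNN ∂Pr ∂lebesgueNN := by
        rw [← lintegral_const_mul _ hWQ.lintegral_prod_right']
        exact lintegral_congr fun s => lintegral_const_mul _ (hWQ.comp measurable_prodMk_left)
    _ ≤ _ := by
        gcongr with s ω
        exact hq _

end Thinning

/-! ### Convolution inequalities on the half line -/

theorem lintegral_sub_left_le {k : ℝ → ℝ≥0∞} (hk : Measurable k) (t : ℝ) :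
    ∫⁻ s : ℝ≥0, k (t - s) ∂lebesgueNN ≤ ∫⁻ x, k x := by
  rw [lintegral_lebesgueNN_coe (f := fun x => k (t - x)) (by fun_prop)]
  exact (setLIntegral_le_lintegral _ _).trans_eq (lintegral_sub_left_eq_self k t)

theorem lintegral_sub_right_le {k : ℝ → ℝ≥0∞} (hk : Measurable k) (s : ℝ) :
    ∫⁻ t : ℝ≥0, k (t - s) ∂lebesgueNN ≤ ∫⁻ x, k x := by
  rw [lintegral_lebesgueNN_coe (f := fun x => k (x - s)) (by fun_prop)]
  exact (setLIntegral_le_lintegral _ _).trans_eq (lintegral_sub_right_eq_self k s)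

/-- An integrable subsolution of a renewal inequality whose kernel has mass `r < 1` is bounded
by the constant solution. -/
theorem le_of_renewal_inequality {A : ℝ≥0 → ℝ≥0∞} (hA : Measurable A) {k : ℝ → ℝ≥0∞}
    (hk : Measurable k) {c : ℝ≥0∞} (hr : ∫⁻ x, k x < 1)
    (hint : ∫⁻ s, A s ∂lebesgueNN ≠ ∞)
    (h : ∀ t : ℝ≥0, A t ≤ c + ∫⁻ s : ℝ≥0, k (t - s) * A s ∂lebesgueNN) (t : ℝ≥0) :
    A t ≤ c / (1 - ∫⁻ x, k x) := by
  set r := ∫⁻ x, k x with hrdef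
  set C := c / (1 - r) with hC
  have h1r : 1 - r ≠ 0 := (tsub_pos_of_lt hr).ne'
  have h1r' : 1 - r ≠ ∞ := ENNReal.sub_ne_top ENNReal.one_ne_top
  -- `C` is the constant solution of the renewal equation.
  have hCeq : c + r * C = C := by
    have : c = (1 - r) * C := by rw [hC, ENNReal.mul_div_cancel h1r h1r']
    rw [this, ← add_mul, tsub_add_cancel_of_le hr.le, one_mul]
  have hB : Measurable fun s => A s - C := hA.sub_const C
  have hconv : ∀ t : ℝ≥0, Measurable fun s : ℝ≥0 => k ((t : ℝ) - s) := fun t =>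
    hk.comp (measurable_const.sub measurable_coe_nnreal_real)
  -- The positive part of A - C (truncated subtraction) satisfies the homogeneous inequality.
  -- Integrating in t multiplies its finite integral by at most r < 1, which forces that integral to
  -- vanish.
  have hBle : ∀ t : ℝ≥0, A t - C ≤ ∫⁻ s : ℝ≥0, k (t - s) * (A s - C) ∂lebesgueNN := by
    intro t
    rw [tsub_le_iff_left]
    calc A t ≤ c + ∫⁻ s : ℝ≥0, k (t - s) * A s ∂lebesgueNN := h t
      _ ≤ c + ∫⁻ s : ℝ≥0, (k (t - s) * C + k (t - s) * (A s - C)) ∂lebesgueNN := by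
          gcongr with s
          rw [← mul_add]
          gcongr
          exact le_add_tsub
      _ = c + ((∫⁻ s : ℝ≥0, k (t - s) ∂lebesgueNN) * C
          + ∫⁻ s : ℝ≥0, k (t - s) * (A s - C) ∂lebesgueNN) := by
          rw [lintegral_add_left ((hconv t).mul_const C), lintegral_mul_const _ (hconv t)]
      _ ≤ c + (r * C + ∫⁻ s : ℝ≥0, k (t - s) * (A s - C) ∂lebesgueNN) := by
          gcongr
          exact lintegral_sub_left_le hk t
      _ = C + ∫⁻ s : ℝ≥0, k (t - s) * (A s - C) ∂lebesgueNN := by rw [← add_assoc, hCeq]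
  have hI : ∫⁻ s, (A s - C) ∂lebesgueNN ≤ r * ∫⁻ s, (A s - C) ∂lebesgueNN := by
    calc ∫⁻ s, (A s - C) ∂lebesgueNN
        ≤ ∫⁻ t : ℝ≥0, ∫⁻ s : ℝ≥0, k (t - s) * (A s - C) ∂lebesgueNN ∂lebesgueNN :=
          lintegral_mono hBle
      _ = ∫⁻ s : ℝ≥0, ∫⁻ t : ℝ≥0, k (t - s) * (A s - C) ∂lebesgueNN ∂lebesgueNN := by
          refine lintegral_lintegral_swap (Measurable.aemeasurable ?_)
          have h2 : Measurable fun z : ℝ≥0 × ℝ≥0 => k ((z.1 : ℝ) - z.2) := by fun_prop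
          exact h2.mul (hB.comp measurable_snd)
      _ ≤ ∫⁻ s : ℝ≥0, r * (A s - C) ∂lebesgueNN := by
          refine lintegral_mono fun s => ?_
          rw [lintegral_mul_const]
          · gcongr
            exact lintegral_sub_right_le hk s
          · fun_prop
      _ = r * ∫⁻ s, (A s - C) ∂lebesgueNN := lintegral_const_mul _ hB
  have hIfin : ∫⁻ s, (A s - C) ∂lebesgueNN ≠ ∞ :=
    ((lintegral_mono fun s => tsub_le_self).trans_lt hint.lt_top).ne
  have hI0 : ∫⁻ s, (A s - C) ∂lebesgueNN = 0 := by
    by_contra hne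
    refine absurd hI (not_le.2 ?_)
    calc r * ∫⁻ s, (A s - C) ∂lebesgueNN < 1 * ∫⁻ s, (A s - C) ∂lebesgueNN :=
          (ENNReal.mul_lt_mul_iff_left hne hIfin).2 hr
      _ = _ := one_mul _
  rw [lintegral_eq_zero_iff hB] at hI0
  -- Vanishing almost everywhere improves to every t, since the convolution on the right ignores
  -- null sets.
  refine tsub_eq_zero_iff_le.1 (le_antisymm ((hBle t).trans ?_) zero_le)
  rw [lintegral_congr_ae (g := fun _ => 0), lintegral_zero]
  filter_upwards [hI0] with s hs
  simp only [Pi.zero_apply] at hs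
  rw [hs, mul_zero]

/-! ### Predictable processes -/

instance : NullSingletonClass lebesgueNN := ⟨lebesgueNN_singleton⟩

section Predictable

variable {Ω : Type*} {m : MeasurableSpace Ω} {F : Filtration ℝ≥0 m}

theorem measurable_fst_predictable : @Measurable _ _ F.predictable _ (Prod.fst : ℝ≥0 × Ω → ℝ≥0) := by
  let _ : MeasurableSpace (ℝ≥0 × Ω) := F.predictable
  refine measurable_of_Ioi fun a => ?_
  rw [← Set.prod_univ]
  exact measurableSet_predictable_Ioi_prod MeasurableSet.univ

theorem isStronglyPredictable_measurable {X : ℝ≥0 → Ω → ℝ} (hX : IsStronglyPredictable F X) :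
    Measurable[F.predictable] fun x : ℝ≥0 × Ω => X x.1 x.2 :=
  StronglyMeasurable.measurable hX

/-- The compensator `∫₀ᵗ X_s⁺ ds`. -/
noncomputable def compensator (X : ℝ≥0 → Ω → ℝ) (t : ℝ≥0) (ω : Ω) : ℝ≥0∞ :=
  ∫⁻ s in Set.Iio t, ENNReal.ofReal (X s ω) ∂lebesgueNN

theorem compensator_mono (X : ℝ≥0 → Ω → ℝ) (ω : Ω) : Monotone fun t => compensator X t ω :=
  fun _ _ hst => lintegral_mono_set (Set.Iio_subset_Iio hst)

/-- Capping the time at t leaves the integral unchanged, and the capped process is jointly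
measurable for `F t` because a predictable process is progressive. -/
theorem measurable_compensator {X : ℝ≥0 → Ω → ℝ} (hX : IsStronglyPredictable F X) (t : ℝ≥0) :
    Measurable[F t] (compensator X t) := by
  have h0 : @Measurable _ _ (@Prod.instMeasurableSpace _ _ _ (F t))
      (@Prod.instMeasurableSpace _ _ _ (F t))
      fun x : ℝ≥0 × Ω => ((⟨min x.1 t, Set.mem_Iic.2 (min_le_right _ _)⟩ : Set.Iic t), x.2) := by
    let _ : MeasurableSpace Ω := F t
    exact ((measurable_fst.min measurable_const).subtype_mk).prodMk measurable_snd
  have h1 : Measurable[@Prod.instMeasurableSpace _ _ _ (F t)]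
      fun x : ℝ≥0 × Ω => X (min x.1 t) x.2 := (hX.isStronglyProgressive t).measurable.comp h0
  have h2 : compensator X t = fun ω => ∫⁻ s, ENNReal.ofReal (X (min s t) ω)
      ∂(lebesgueNN.restrict (Set.Iio t)) := by
    ext ω
    refine setLIntegral_congr_fun measurableSet_Iio fun s hs => ?_
    rw [min_eq_left (le_of_lt hs)]
  rw [h2]
  exact @Measurable.lintegral_prod_left' _ _ _ (F t) _ _ _ h1.ennreal_ofReal

/-- The compensator is left continuous, since `Iio t` is exhausted by the intervals `Iio q`.
Exceeding a level thereby becomes a countable union of predictable rectangles over half-lines. -/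
theorem exists_lt_compensator {X : ℝ≥0 → Ω → ℝ} {D : Set ℝ≥0} (hDc : D.Countable) (hD : Dense D)
    {t : ℝ≥0} {ω : Ω} {c : ℝ≥0∞} (h : c < compensator X t ω) :
    ∃ q ∈ D, q < t ∧ c < compensator X q ω := by
  have := (hDc.mono (Set.inter_subset_left (t := Set.Iio t))).to_subtype
  have hU : Set.Iio t = ⋃ q : ↥(D ∩ Set.Iio t), Set.Iio (q : ℝ≥0) := by
    ext s
    simp only [Set.mem_iUnion, Set.mem_Iio, Subtype.exists, Set.mem_inter_iff, exists_prop]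
    constructor
    · intro hs
      obtain ⟨q, hq, h1, h2⟩ := hD.exists_between hs
      exact ⟨q, ⟨hq, h2⟩, h1⟩
    · rintro ⟨q, ⟨-, hq⟩, hs⟩
      exact hs.trans hq
  have hdir : Directed (· ⊆ ·) fun q : ↥(D ∩ Set.Iio t) => Set.Iio (q : ℝ≥0) :=
    (show Monotone fun q : ↥(D ∩ Set.Iio t) => Set.Iio (q : ℝ≥0) from
      fun a b hab => Set.Iio_subset_Iio hab).directed_le
  rw [compensator, hU, setLIntegral_iUnion_of_directed _ hdir, lt_iSup_iff] at h
  obtain ⟨q, hq⟩ := h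
  exact ⟨q, q.2.1, q.2.2, hq⟩

/-- The indicator of the times in `[0, T]` at which the compensator is at most `n`. -/
noncomputable def localizer (X : ℝ≥0 → Ω → ℝ) (T : ℝ≥0) (n : ℕ) (x : ℝ≥0 × Ω) : ℝ≥0∞ :=
  open Classical in if x.1 ≤ T ∧ compensator X x.1 x.2 ≤ n then 1 else 0

/-- If the localisation is active at t it is active throughout the past of t, so it can be inserted
under the integral over past points. -/
theorem localizer_anti (X : ℝ≥0 → Ω → ℝ) (T : ℝ≥0) (n : ℕ) {s t : ℝ≥0} (hst : s ≤ t) (ω : Ω)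
    (h : localizer X T n (t, ω) ≠ 0) : localizer X T n (s, ω) = 1 := by
  classical
  simp only [localizer] at h ⊢
  rw [if_pos]
  have h' : t ≤ T ∧ compensator X t ω ≤ n := by by_contra hc; exact h (if_neg hc)
  exact ⟨hst.trans h'.1, (compensator_mono X ω hst).trans h'.2⟩

theorem localizer_le_one (X : ℝ≥0 → Ω → ℝ) (T : ℝ≥0) (n : ℕ) (x : ℝ≥0 × Ω) :
    localizer X T n x ≤ 1 := by
  rw [localizer]; split_ifs <;> simp

theorem localizer_mono (X : ℝ≥0 → Ω → ℝ) (T : ℝ≥0) (x : ℝ≥0 × Ω) :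
    Monotone fun n => localizer X T n x := by
  intro n n' hn
  simp only [localizer]
  by_cases h : x.1 ≤ T ∧ compensator X x.1 x.2 ≤ n
  · rw [if_pos h, if_pos ⟨h.1, h.2.trans (by exact_mod_cast hn)⟩]
  · rw [if_neg h]; exact zero_le

theorem iSup_localizer (X : ℝ≥0 → Ω → ℝ) {T t : ℝ≥0} (ht : t ≤ T) {ω : Ω}
    (h : compensator X t ω < ∞) : ⨆ n, localizer X T n (t, ω) = 1 := by
  refine le_antisymm (iSup_le fun n => localizer_le_one X T n _) ?_
  obtain ⟨n, hn⟩ := ENNReal.exists_nat_gt h.ne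
  refine le_iSup_of_le n ?_
  rw [localizer, if_pos ⟨ht, hn.le⟩]

theorem measurable_localizer {X : ℝ≥0 → Ω → ℝ} (hX : IsStronglyPredictable F X) (T : ℝ≥0)
    (n : ℕ) : Measurable[F.predictable] (localizer X T n) := by
  classical
  obtain ⟨D, hDc, hD⟩ := TopologicalSpace.exists_countable_dense ℝ≥0
  have h1 : MeasurableSet[F.predictable] {x : ℝ≥0 × Ω | x.1 ≤ T} :=
    measurable_fst_predictable measurableSet_Iic
  have h2 : MeasurableSet[F.predictable] {x : ℝ≥0 × Ω | compensator X x.1 x.2 ≤ n} := by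
    have : {x : ℝ≥0 × Ω | compensator X x.1 x.2 ≤ n} =
        (⋃ q ∈ D, Set.Ioi q ×ˢ {ω | (n : ℝ≥0∞) < compensator X q ω})ᶜ := by
      ext ⟨t, ω⟩
      simp only [Set.mem_ofPred_eq, Set.mem_compl_iff, Set.mem_iUnion, Set.mem_prod, Set.mem_Ioi,
        exists_prop, ← not_lt, not_iff_not]
      constructor
      · exact exists_lt_compensator hDc hD
      · rintro ⟨q, -, hq, h⟩
        exact h.trans_le (compensator_mono X ω hq.le)
    rw [this]
    refine MeasurableSet.compl (MeasurableSet.biUnion hDc fun q _ => ?_)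
    exact measurableSet_predictable_Ioi_prod
      (measurable_compensator hX q measurableSet_Ioi)
  exact Measurable.ite (h1.inter h2) measurable_const measurable_const

/-- This is the a priori integrability required by the renewal argument. The admissible times form
an initial segment, exhausted by intervals on which the compensator is at most n, up to one possible
end point. -/
theorem lintegral_localizer_mul_le (X : ℝ≥0 → Ω → ℝ) (T : ℝ≥0) (n : ℕ) (ω : Ω) :
    ∫⁻ t, localizer X T n (t, ω) * ENNReal.ofReal (X t ω) ∂lebesgueNN ≤ n := by
  obtain ⟨D, hDc, hD⟩ := TopologicalSpace.exists_countable_dense ℝ≥0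
  let J : Set ℝ≥0 := {t | compensator X t ω ≤ n}
  have := (hDc.mono (Set.inter_subset_left (t := J))).to_subtype
  let U : Set ℝ≥0 := ⋃ q : ↥(D ∩ J), Set.Iio (q : ℝ≥0)
  have hU : MeasurableSet U := MeasurableSet.iUnion fun q => measurableSet_Iio
  -- Only the right end point of `J` can be missed, and Lebesgue measure has no atoms.
  have hrem : (J \ U).Subsingleton := by
    have key : ∀ x ∈ J \ U, ∀ y ∈ J \ U, ¬ x < y := by
      intro x hx y hy hxy
      obtain ⟨q, hq, h1, h2⟩ := hD.exists_between hxy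
      exact hx.2 (Set.mem_iUnion.2 ⟨⟨q, hq, (compensator_mono X ω h2.le).trans hy.1⟩, h1⟩)
    exact fun x hx y hy => le_antisymm (not_lt.1 (key y hy x hx)) (not_lt.1 (key x hx y hy))
  have hdir : Directed (· ⊆ ·) fun q : ↥(D ∩ J) => Set.Iio (q : ℝ≥0) :=
    (show Monotone fun q : ↥(D ∩ J) => Set.Iio (q : ℝ≥0) from
      fun a b hab => Set.Iio_subset_Iio hab).directed_le
  have hnull : ∀ᵐ t ∂lebesgueNN, t ∉ J \ U :=
    measure_eq_zero_iff_ae_notMem.1 (hrem.measure_zero lebesgueNN)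
  calc ∫⁻ t, localizer X T n (t, ω) * ENNReal.ofReal (X t ω) ∂lebesgueNN
      ≤ ∫⁻ t, U.indicator (fun t => ENNReal.ofReal (X t ω)) t ∂lebesgueNN := by
        refine lintegral_mono_ae (hnull.mono fun t ht => ?_)
        by_cases htJ : t ∈ J
        · have htU : t ∈ U := by by_contra h; exact ht ⟨htJ, h⟩
          rw [Set.indicator_of_mem htU]
          exact mul_le_of_le_one_left' (localizer_le_one X T n _)
        · rw [localizer, if_neg (fun h => htJ h.2), zero_mul]
          exact zero_le
    _ = ⨆ q : ↥(D ∩ J), compensator X q ω := by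
        rw [lintegral_indicator hU, setLIntegral_iUnion_of_directed _ hdir]
        rfl
    _ ≤ n := iSup_le fun q => q.2.2

end Predictable

/-! ### Point measures -/

/-- Finite mass leaves finitely many atoms in `S`, as each counts for one, so the integral is a
finite sum of finite values. No integrability of `f` is required. -/
theorem IsPointMeasure.setLIntegral_lt_top {E : Type*} [MeasurableSpace E] {m : Measure E}
    (hm : IsPointMeasure m) {S : Set E} (hS : MeasurableSet S) (hfin : m S < ∞) {f : E → ℝ≥0∞}
    (hf : Measurable f) (hf' : ∀ x, f x ≠ ∞) : ∫⁻ x in S, f x ∂m < ∞ := by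
  classical
  obtain ⟨ι, _, x, rfl⟩ := hm
  rw [← lintegral_indicator hS, lintegral_sum_measure]
  simp only [lintegral_dirac' _ (hf.indicator hS)]
  rw [Measure.sum_apply _ hS] at hfin
  simp only [Measure.dirac_apply' _ hS] at hfin
  have hfs := ENNReal.finite_const_le_of_tsum_ne_top hfin.ne one_ne_zero
  rw [tsum_eq_sum (s := hfs.toFinset)]
  · refine ENNReal.sum_lt_top.2 fun i _ => ?_
    exact (Set.indicator_le_self S f (x i)).trans_lt (hf' _).lt_top
  · intro i hi
    refine Set.indicator_of_notMem (fun hx => hi ?_) _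
    simp [hx]

/-! ### The mean intensity -/

/-- The absolute value of the kernel `h`, cut off outside `(0, T]`. -/
noncomputable def absKernel (h : ℝ → ℝ) (T : ℝ≥0) (x : ℝ) : ℝ≥0∞ :=
  (Set.Ioc 0 (T : ℝ)).indicator (fun x => ‖h x‖ₑ) x

theorem measurable_absKernel {h : ℝ → ℝ} (hh : Measurable h) (T : ℝ≥0) :
    Measurable (absKernel h T) := hh.enorm.indicator measurableSet_Ioc

theorem lintegral_absKernel {h : ℝ → ℝ} {T : ℝ≥0} (hint : IntegrableOn h (Set.Icc 0 (T : ℝ))) :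
    ∫⁻ x, absKernel h T x = ENNReal.ofReal (∫ x in (0 : ℝ)..T, |h x|) := by
  unfold absKernel
  rw [lintegral_indicator measurableSet_Ioc, intervalIntegral.integral_of_le T.coe_nonneg,
    ofReal_integral_eq_lintegral_ofReal]
  · simp [Real.enorm_eq_ofReal_abs]
  · exact (hint.mono_set Set.Ioc_subset_Icc_self).abs
  · exact Filter.Eventually.of_forall fun x => abs_nonneg _

theorem ofReal_lipschitz_le {L : ℝ≥0} {ψ : ℝ → ℝ} (hψ : LipschitzWith L ψ) (x y : ℝ) :
    ENNReal.ofReal |ψ x - ψ y| ≤ L * ‖x - y‖ₑ := by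
  rw [Real.enorm_eq_ofReal_abs, ← ENNReal.ofReal_coe_nnreal, ← ENNReal.ofReal_mul L.coe_nonneg]
  exact ENNReal.ofReal_le_ofReal (hψ.dist_le_mul x y)

theorem ofReal_lipschitz_le_add {L : ℝ≥0} {ψ : ℝ → ℝ} (hψ : LipschitzWith L ψ) (x : ℝ) :
    ENNReal.ofReal (ψ x) ≤ ENNReal.ofReal (ψ 0) + L * ‖x‖ₑ := by
  calc ENNReal.ofReal (ψ x) ≤ ENNReal.ofReal (ψ 0 + |ψ x - ψ 0|) :=
        ENNReal.ofReal_le_ofReal (by linarith [le_abs_self (ψ x - ψ 0)])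
    _ ≤ ENNReal.ofReal (ψ 0) + ENNReal.ofReal |ψ x - ψ 0| := ENNReal.ofReal_add_le
    _ ≤ ENNReal.ofReal (ψ 0) + L * ‖x‖ₑ := by
        gcongr
        simpa using ofReal_lipschitz_le hψ x 0

theorem measurableSet_thinned {l : ℝ≥0 → ℝ} (hl : Measurable l) {I : Set ℝ≥0}
    (hI : MeasurableSet I) : MeasurableSet {p : Pt | p.1 ∈ I ∧ (p.2.1 : ℝ) ≤ l p.1} :=
  (measurable_fst hI).inter (measurableSet_le
    (f := fun p : Pt => (p.2.1 : ℝ)) (g := fun p : Pt => l p.1) (by fun_prop) (by fun_prop))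

theorem measurable_markedWeight {w : ℝ≥0 → ℝ≥0∞} {l : ℝ≥0 → ℝ} {b : ℝ → ℝ} (hw : Measurable w)
    (hl : Measurable l) (hb : Measurable b) :
    Measurable fun p : Pt => w p.1 * below (l p.1) p.2.1 * ENNReal.ofReal (b p.2.2) := by
  have := measurable_below (hl.comp measurable_fst)
    (measurable_fst.comp measurable_snd : Measurable fun p : Pt => p.2.1)
  simp only [Function.comp_def] at this
  fun_prop

/-- Linear growth of ψ is combined with the triangle inequality for integrals, which holds even
without integrability. Cutting the kernel off outside (0, T] loses nothing, as past points satisfy 0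
< t - s ≤ T. -/
theorem intensity_le {L T : ℝ≥0} {h ψ b : ℝ → ℝ} (hψ : LipschitzWith L ψ)
    (hb_nonneg : ∀ y, 0 ≤ b y) {l : ℝ≥0 → ℝ} (hl : Measurable l) {t : ℝ≥0} (ht : t ≤ T)
    (m : Measure Pt)
    (heq : l t = ψ (∫ p in {p : Pt | p.1 < t ∧ (p.2.1 : ℝ) ≤ l p.1},
      h ((t : ℝ) - (p.1 : ℝ)) * b p.2.2 ∂m)) :
    ENNReal.ofReal (l t) ≤ ENNReal.ofReal (ψ 0) +
      L * ∫⁻ p, absKernel h T (t - p.1) * below (l p.1) p.2.1 * ENNReal.ofReal (b p.2.2) ∂m := by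
  have hS : MeasurableSet {p : Pt | p.1 < t ∧ (p.2.1 : ℝ) ≤ l p.1} :=
    measurableSet_thinned hl measurableSet_Iio
  rw [heq]
  refine (ofReal_lipschitz_le_add hψ _).trans ?_
  gcongr
  refine (enorm_integral_le_lintegral_enorm _).trans ?_
  rw [← lintegral_indicator hS]
  refine lintegral_mono fun p => ?_
  rw [Set.indicator_apply]
  split_ifs with hp
  swap
  · exact zero_le
  have h1 : (p.1 : ℝ) < t := hp.1
  have h2 : (t : ℝ) ≤ T := ht
  have h3 : (0 : ℝ) ≤ p.1 := p.1.2
  have hmem : (t : ℝ) - p.1 ∈ Set.Ioc 0 (T : ℝ) := ⟨by linarith, by linarith⟩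
  rw [absKernel, Set.indicator_of_mem hmem, below, if_pos hp.2, mul_one,
    enorm_mul, Real.enorm_eq_ofReal (hb_nonneg _)]

section Moment

variable {Ω : Type*} [mΩ : MeasurableSpace Ω] {Pr : Measure Ω} [IsProbabilityMeasure Pr]
  {ν : Measure ℝ} [IsProbabilityMeasure ν] {P : Ω → Measure Pt} {T : ℝ≥0} {h ψ b : ℝ → ℝ}
  {L : ℝ≥0} {lam : ℝ≥0 → Ω → ℝ}

theorem IsPoissonRandomMeasure.lintegral_below_le
    (hP : IsPoissonRandomMeasure Pr (intensityMeasure ν) P) (hb : Measurable b)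
    {w : ℝ≥0 × Ω → ℝ≥0∞} {l : ℝ≥0 × Ω → ℝ}
    (hw : Measurable[(naturalFiltration P hP.measurable).predictable] w)
    (hl : Measurable[(naturalFiltration P hP.measurable).predictable] l) :
    ∫⁻ ω, ∫⁻ p, w (p.1, ω) * below (l (p.1, ω)) p.2.1 * ENNReal.ofReal (b p.2.2) ∂P ω ∂Pr ≤
      meanMark ν b * ∫⁻ s, ∫⁻ ω, w (s, ω) * ENNReal.ofReal (l (s, ω)) ∂Pr ∂lebesgueNN := by
  refine hP.lintegral_marked_le (d := fun x θ => below (l x) θ)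
    (q := fun x => ENNReal.ofReal (l x)) hb hw ?_ (fun x => HawkesApprox.lintegral_below_le _)
  let _ : MeasurableSpace (ℝ≥0 × Ω) := (naturalFiltration P hP.measurable).predictable
  exact measurable_below (hl.comp measurable_fst) measurable_snd

theorem IsPoissonRandomMeasure.lintegral_between_le
    (hP : IsPoissonRandomMeasure Pr (intensityMeasure ν) P) (hb : Measurable b)
    {w : ℝ≥0 × Ω → ℝ≥0∞} {l l' : ℝ≥0 × Ω → ℝ}
    (hw : Measurable[(naturalFiltration P hP.measurable).predictable] w)
    (hl : Measurable[(naturalFiltration P hP.measurable).predictable] l)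
    (hl' : Measurable[(naturalFiltration P hP.measurable).predictable] l') :
    ∫⁻ ω, ∫⁻ p, w (p.1, ω) * between (l (p.1, ω)) (l' (p.1, ω)) p.2.1 *
        ENNReal.ofReal (b p.2.2) ∂P ω ∂Pr ≤
      meanMark ν b * ∫⁻ s, ∫⁻ ω, w (s, ω) * ENNReal.ofReal |l (s, ω) - l' (s, ω)| ∂Pr
        ∂lebesgueNN := by
  refine hP.lintegral_marked_le (d := fun x θ => between (l x) (l' x) θ)
    (q := fun x => ENNReal.ofReal |l x - l' x|) hb hw ?_
    (fun x => HawkesApprox.lintegral_between_le _ _)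
  let _ : MeasurableSpace (ℝ≥0 × Ω) := (naturalFiltration P hP.measurable).predictable
  exact measurable_between (hl.comp measurable_fst) (hl'.comp measurable_fst) measurable_snd

theorem measurable_uncurry_of_predictable {F : Filtration ℝ≥0 mΩ}
    (hX : IsStronglyPredictable F lam) : Measurable fun x : ℝ≥0 × Ω => lam x.1 x.2 :=
  (isStronglyPredictable_measurable hX).mono (predictable_le F) le_rfl

theorem measurable_path_of_predictable {F : Filtration ℝ≥0 mΩ}
    (hX : IsStronglyPredictable F lam) (ω : Ω) : Measurable fun s => lam s ω :=
  (measurable_uncurry_of_predictable hX).comp (g := fun x : ℝ≥0 × Ω => lam x.1 x.2)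
    (f := fun s => (s, ω)) measurable_prodMk_right

omit [IsProbabilityMeasure Pr] [IsProbabilityMeasure ν] in
-- Finitely many points are accepted up to T, so their total mark is finite; Fubini bounds the
-- compensator by ψ(0)t plus L times the L¹ norm of h times that mark. Hence the localisations
-- increase to 1.
theorem IsHawkesIntensity.ae_compensator_lt_top
    (hP : IsPoissonRandomMeasure Pr (intensityMeasure ν) P)
    (hlam : IsHawkesIntensity Pr P hP.measurable T h ψ b lam) (hψ : LipschitzWith L ψ)
    (hb_nonneg : ∀ y, 0 ≤ b y) (hb : Measurable b) (hh : Measurable h)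
    (hint : IntegrableOn h (Set.Icc 0 (T : ℝ))) :
    ∀ᵐ ω ∂Pr, ∀ t ≤ T, compensator lam t ω < ∞ := by
  filter_upwards [hlam.nonexplosive, hlam.equation] with ω hfin heq t ht
  have hl := measurable_path_of_predictable hlam.predictable ω
  have hS := measurableSet_thinned hl (measurableSet_Iic (a := T))
  set S := {p : Pt | p.1 ∈ Set.Iic T ∧ (p.2.1 : ℝ) ≤ lam p.1 ω}
  have hkm := measurable_absKernel hh T
  have hSb : ∫⁻ p in S, ENNReal.ofReal (b p.2.2) ∂P ω < ∞ :=
    (hP.isPointMeasure ω).setLIntegral_lt_top hS hfin (by fun_prop) (by simp)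
  have : IsFiniteMeasure ((P ω).restrict S) := ⟨by rwa [Measure.restrict_apply_univ]⟩
  have hk : ∫⁻ x, absKernel h T x < ∞ := by
    rw [lintegral_absKernel hint]; exact ENNReal.ofReal_lt_top
  have hle : ∀ s ∈ Set.Iio t, ENNReal.ofReal (lam s ω) ≤ ENNReal.ofReal (ψ 0) +
      L * ∫⁻ p in S, absKernel h T (s - p.1) * ENNReal.ofReal (b p.2.2) ∂P ω := by
    intro s hs
    have hsT : s ≤ T := (le_of_lt hs).trans ht
    refine (intensity_le hψ hb_nonneg hl hsT (P ω) (heq s hsT)).trans ?_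
    refine add_le_add le_rfl (mul_le_mul' le_rfl ?_)
    rw [← lintegral_indicator hS]
    refine lintegral_mono fun p => ?_
    by_cases hp : p ∈ S
    · rw [Set.indicator_of_mem hp]
      gcongr
      exact mul_le_of_le_one_right' (by rw [below]; split_ifs <;> simp)
    · rw [Set.indicator_of_notMem hp]
      by_cases h1 : (p.2.1 : ℝ) ≤ lam p.1 ω
      · have h2 : ¬ p.1 ≤ T := fun h' => hp ⟨h', h1⟩
        have h3 : (T : ℝ) < p.1 := by exact_mod_cast not_le.1 h2
        have h4 : (s : ℝ) ≤ T := hsT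
        rw [absKernel, Set.indicator_of_notMem (fun h' => by linarith [h'.1]), zero_mul, zero_mul]
      · rw [below, if_neg h1, mul_zero, zero_mul]
  calc compensator lam t ω
      ≤ ∫⁻ s in Set.Iio t, (ENNReal.ofReal (ψ 0) +
          L * ∫⁻ p in S, absKernel h T (s - p.1) * ENNReal.ofReal (b p.2.2) ∂P ω) ∂lebesgueNN :=
        setLIntegral_mono' measurableSet_Iio hle
    _ = ENNReal.ofReal (ψ 0) * lebesgueNN (Set.Iio t) + ∫⁻ s in Set.Iio t,
          L * ∫⁻ p in S, absKernel h T (s - p.1) * ENNReal.ofReal (b p.2.2) ∂P ω ∂lebesgueNN := by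
        rw [lintegral_add_left measurable_const, setLIntegral_const]
    _ ≤ ENNReal.ofReal (ψ 0) * t + L * ∫⁻ s,
          ∫⁻ p in S, absKernel h T (s - p.1) * ENNReal.ofReal (b p.2.2) ∂P ω ∂lebesgueNN := by
        gcongr
        · rw [← lebesgueNN_Iic]; exact measure_mono Set.Iio_subset_Iic_self
        · rw [← lintegral_const_mul' _ _ ENNReal.coe_ne_top]
          exact setLIntegral_le_lintegral _ _
    _ = ENNReal.ofReal (ψ 0) * t + L * ∫⁻ p in S, (∫⁻ s : ℝ≥0, absKernel h T (s - p.1) ∂lebesgueNN)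
          * ENNReal.ofReal (b p.2.2) ∂P ω := by
        congr 2
        rw [lintegral_lintegral_swap]
        · refine lintegral_congr fun p => lintegral_mul_const _ (by fun_prop)
        · exact Measurable.aemeasurable (by fun_prop)
    _ ≤ ENNReal.ofReal (ψ 0) * t + L * ∫⁻ p in S, (∫⁻ x, absKernel h T x)
          * ENNReal.ofReal (b p.2.2) ∂P ω := by
        gcongr
        exact lintegral_sub_right_le hkm _
    _ < ∞ := by
        rw [lintegral_const_mul _ (by fun_prop)]
        finiteness

/-- The mean intensity is bounded by `ψ 0 / (1 - ρ)`. -/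
theorem IsHawkesIntensity.lintegral_le
    (hP : IsPoissonRandomMeasure Pr (intensityMeasure ν) P)
    (hlam : IsHawkesIntensity Pr P hP.measurable T h ψ b lam) (hψ : LipschitzWith L ψ)
    (hb_nonneg : ∀ y, 0 ≤ b y) (hb : Measurable b) (hh : Measurable h)
    (hint : IntegrableOn h (Set.Icc 0 (T : ℝ)))
    (hr : L * meanMark ν b * ∫⁻ x, absKernel h T x < 1) {t : ℝ≥0} (ht : t ≤ T) :
    ∫⁻ ω, ENNReal.ofReal (lam t ω) ∂Pr ≤
      ENNReal.ofReal (ψ 0) / (1 - L * meanMark ν b * ∫⁻ x, absKernel h T x) := by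
  have hkm := measurable_absKernel hh T
  have hlm := measurable_uncurry_of_predictable hlam.predictable
  have hlp := isStronglyPredictable_measurable hlam.predictable
  have hφp := fun n => measurable_localizer hlam.predictable T n
  have hφm := fun n => (hφp n).mono (predictable_le _) le_rfl
  have hφl : ∀ n, Measurable fun x : ℝ≥0 × Ω => localizer lam T n x * ENNReal.ofReal (lam x.1 x.2) :=
    fun n => (hφm n).mul hlm.ennreal_ofReal
  -- The mean of λ_t is not yet known to be finite, so the renewal inequality is applied to the
  -- localised mean; monotone convergence in n then removes the localisation.
  have hbound : ∀ n, ∫⁻ ω, localizer lam T n (t, ω) * ENNReal.ofReal (lam t ω) ∂Pr ≤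
      ENNReal.ofReal (ψ 0) / (1 - L * meanMark ν b * ∫⁻ x, absKernel h T x) := by
    intro n
    have hA : Measurable fun t => ∫⁻ ω, localizer lam T n (t, ω) * ENNReal.ofReal (lam t ω) ∂Pr :=
      (hφl n).lintegral_prod_right'
    have hker : ∫⁻ x, L * meanMark ν b * absKernel h T x =
        L * meanMark ν b * ∫⁻ x, absKernel h T x := lintegral_const_mul _ hkm
    rw [← hker] at hr ⊢
    refine le_of_renewal_inequality hA (hkm.const_mul _) hr ?_ (fun t => ?_) t
    · rw [lintegral_lintegral_swap (hφl n).aemeasurable]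
      refine ((lintegral_mono fun ω =>
        lintegral_localizer_mul_le lam T n ω).trans_lt ?_).ne
      simp
    · calc ∫⁻ ω, localizer lam T n (t, ω) * ENNReal.ofReal (lam t ω) ∂Pr
          ≤ ∫⁻ ω, (ENNReal.ofReal (ψ 0) + L * ∫⁻ p, (absKernel h T (t - p.1) *
              localizer lam T n (p.1, ω)) * below (lam p.1 ω) p.2.1 *
              ENNReal.ofReal (b p.2.2) ∂P ω) ∂Pr := by
            refine lintegral_mono_ae (hlam.equation.mono fun ω heq => ?_)
            by_cases h0 : localizer lam T n (t, ω) = 0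
            · rw [h0, zero_mul]; exact zero_le
            have htT : t ≤ T := by
              by_contra hc
              exact h0 (by rw [localizer, if_neg (fun h' => hc h'.1)])
            refine (mul_le_of_le_one_left' (localizer_le_one lam T n _)).trans ?_
            refine (intensity_le hψ hb_nonneg (measurable_path_of_predictable hlam.predictable ω)
              htT (P ω) (heq t htT)).trans ?_
            gcongr with p
            -- Past points inherit the localisation active at t, and later points are killed by the
            -- kernel.
            by_cases hp : p.1 ≤ t
            · rw [localizer_anti lam T n hp ω h0, mul_one]
            · have : (t : ℝ) < p.1 := by exact_mod_cast not_le.1 hp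
              rw [absKernel, Set.indicator_of_notMem (fun h' => by linarith [h'.1]), zero_mul]
        _ = ENNReal.ofReal (ψ 0) + L * ∫⁻ ω, ∫⁻ p, (absKernel h T (t - p.1) *
              localizer lam T n (p.1, ω)) * below (lam p.1 ω) p.2.1 *
              ENNReal.ofReal (b p.2.2) ∂P ω ∂Pr := by
            rw [lintegral_add_left measurable_const, lintegral_const, measure_univ, mul_one,
              lintegral_const_mul' _ _ ENNReal.coe_ne_top]
        _ ≤ ENNReal.ofReal (ψ 0) + L * (meanMark ν b * ∫⁻ s : ℝ≥0, ∫⁻ ω, (absKernel h T (t - s) *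
              localizer lam T n (s, ω)) * ENNReal.ofReal (lam s ω) ∂Pr ∂lebesgueNN) := by
            gcongr
            refine hP.lintegral_below_le (w := fun x => absKernel h T (t - x.1) *
              localizer lam T n x) (l := fun x => lam x.1 x.2) hb ?_ hlp
            refine Measurable.mul ?_ (hφp n)
            have h1 : Measurable fun s : ℝ≥0 => absKernel h T (t - s) := by fun_prop
            exact h1.comp measurable_fst_predictable
        _ = _ := by
            congr 1
            rw [← mul_assoc, ← lintegral_const_mul]
            · refine lintegral_congr fun s => ?_
              rw [mul_assoc (_ * _), ← lintegral_const_mul (absKernel h T (t - s))]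
              · simp only [mul_assoc]
              · exact (hφl n).comp (f := fun ω => (s, ω)) measurable_prodMk_left
            · have h1 : Measurable fun x : ℝ≥0 × Ω => absKernel h T (t - x.1) := by fun_prop
              exact ((h1.mul (hφm n)).mul hlm.ennreal_ofReal).lintegral_prod_right'
  calc ∫⁻ ω, ENNReal.ofReal (lam t ω) ∂Pr
      = ∫⁻ ω, ⨆ n, localizer lam T n (t, ω) * ENNReal.ofReal (lam t ω) ∂Pr := by
        refine lintegral_congr_ae ?_
        filter_upwards [hlam.ae_compensator_lt_top hP hψ hb_nonneg hb hh hint] with ω hω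
        rw [← ENNReal.iSup_mul, iSup_localizer lam ht (hω t ht), one_mul]
    _ = ⨆ n, ∫⁻ ω, localizer lam T n (t, ω) * ENNReal.ofReal (lam t ω) ∂Pr := by
        refine lintegral_iSup (fun n => (hφl n).comp measurable_prodMk_left) ?_
        intro n n' hn ω
        simp only
        gcongr
        exact localizer_mono lam T (t, ω) hn
    _ ≤ _ := iSup_le hbound

end Moment

/-! ### Moduli of regularity of the kernel -/

/-- The weight `h (t - s)` of the past time `s < t`. -/
noncomputable def pastWeight (h : ℝ → ℝ) (t s : ℝ≥0) : ℝ :=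
  if s < t then h ((t : ℝ) - s) else 0

/-- The weight `h ((n - k) Δ)` of the past time `s` of the `k`-th bin, `1 ≤ k < n`. -/
noncomputable def binWeight (h : ℝ → ℝ) (Δ : ℝ≥0) (n : ℕ) (s : ℝ≥0) : ℝ :=
  if 1 ≤ ⌈s / Δ⌉₊ ∧ ⌈s / Δ⌉₊ < n then h (((n - ⌈s / Δ⌉₊ : ℕ) : ℝ) * Δ) else 0

theorem measurable_pastWeight {h : ℝ → ℝ} (hh : Measurable h) (t : ℝ≥0) :
    Measurable (pastWeight h t) :=
  Measurable.ite measurableSet_Iio (by fun_prop) measurable_const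

theorem measurable_binWeight (h : ℝ → ℝ) (Δ : ℝ≥0) (n : ℕ) : Measurable (binWeight h Δ n) := by
  have h1 : Measurable fun s : ℝ≥0 => ⌈s / Δ⌉₊ := Nat.measurable_ceil.comp (measurable_id.div_const Δ)
  exact (measurable_of_countable
    fun k : ℕ => if 1 ≤ k ∧ k < n then h (((n - k : ℕ) : ℝ) * Δ) else 0).comp h1

/-- The time `s` lies in the `k`-th bin if and only if `⌈s / Δ⌉ = k`. -/
theorem mem_bin_iff {Δ : ℝ≥0} (hΔ : 0 < Δ) {k : ℕ} (hk : 1 ≤ k) (s : ℝ≥0) :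
    s ∈ Set.Ioc (((k - 1 : ℕ) : ℝ≥0) * Δ) ((k : ℝ≥0) * Δ) ↔ ⌈s / Δ⌉₊ = k := by
  rw [Nat.ceil_eq_iff (by omega), lt_div_iff₀ hΔ, div_le_iff₀ hΔ]
  rfl

/-- The shifted increments of `h`. -/
noncomputable def shiftModulus (h : ℝ → ℝ) (a ε x : ℝ) : ℝ≥0∞ :=
  (Set.Icc 0 a).indicator (fun x => ‖h (x + ε) - h x‖ₑ) x

/-- The distance of `h` to its discretisation. -/
noncomputable def gridModulus (h : ℝ → ℝ) (Δ : ℝ≥0) (a x : ℝ) : ℝ≥0∞ :=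
  (Set.Icc 0 a).indicator (fun x => ‖h x - h ((⌊x / (Δ : ℝ)⌋₊ : ℝ) * Δ + Δ)‖ₑ) x

theorem measurable_shiftModulus {h : ℝ → ℝ} (hh : Measurable h) (a ε : ℝ) :
    Measurable (shiftModulus h a ε) :=
  Measurable.indicator (by fun_prop) measurableSet_Icc

theorem measurable_grid (h : ℝ → ℝ) (Δ : ℝ≥0) :
    Measurable fun x : ℝ => h ((⌊x / (Δ : ℝ)⌋₊ : ℝ) * Δ + Δ) :=
  (measurable_of_countable fun k : ℕ => h ((k : ℝ) * Δ + Δ)).comp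
    (Nat.measurable_floor.comp (measurable_id.div_const (Δ : ℝ)))

theorem measurable_gridModulus {h : ℝ → ℝ} (hh : Measurable h) (Δ : ℝ≥0) (a : ℝ) :
    Measurable (gridModulus h Δ a) :=
  (hh.sub (measurable_grid h Δ)).enorm.indicator measurableSet_Icc

theorem lintegral_indicator_Icc_enorm {f : ℝ → ℝ} {a : ℝ} (ha : 0 ≤ a)
    (hf : IntegrableOn f (Set.Icc 0 a)) :
    ∫⁻ x, (Set.Icc 0 a).indicator (fun x => ‖f x‖ₑ) x =
      ENNReal.ofReal (∫ x in (0 : ℝ)..a, |f x|) := by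
  rw [lintegral_indicator measurableSet_Icc, intervalIntegral.integral_of_le ha,
    ← integral_Icc_eq_integral_Ioc, ofReal_integral_eq_lintegral_ofReal hf.abs
    (Filter.Eventually.of_forall fun x => abs_nonneg _)]
  simp [Real.enorm_eq_ofReal_abs]

section Modulus

variable {T Δ : ℝ≥0} {M : ℕ} {h : ℝ → ℝ}

theorem integrableOn_shift (hint : IntegrableOn h (Set.Icc 0 (T : ℝ))) {ε : ℝ}
    (hε : ε ∈ Set.Icc 0 (Δ : ℝ)) :
    IntegrableOn (fun x => h (x + ε)) (Set.Icc 0 ((T : ℝ) - Δ)) := by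
  have h1 : IntegrableOn (fun x => h (x + ε)) ((fun x => x + ε) ⁻¹' Set.Icc 0 (T : ℝ)) :=
    ((measurePreserving_add_right volume ε).integrableOn_comp_preimage
      (measurableEmbedding_addRight ε)).2 hint
  refine h1.mono_set fun x hx => ?_
  simp only [Set.mem_preimage, Set.mem_Icc] at hx hε ⊢
  exact ⟨by linarith [hx.1, hε.1], by linarith [hx.2, hε.2]⟩

theorem integrableOn_shift_sub (hint : IntegrableOn h (Set.Icc 0 (T : ℝ))) {ε : ℝ}
    (hε : ε ∈ Set.Icc 0 (Δ : ℝ)) :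
    IntegrableOn (fun x => h (x + ε) - h x) (Set.Icc 0 ((T : ℝ) - Δ)) :=
  (integrableOn_shift hint hε).sub
    (hint.mono_set (Set.Icc_subset_Icc_right (by linarith [Δ.coe_nonneg])))

/-- A real supremum of an unbounded family is 0 by convention, so boundedness must be known before
the supremum in C_R controls each shift; twice the L¹ norm of h is a bound. -/
theorem bddAbove_shift (hint : IntegrableOn h (Set.Icc 0 (T : ℝ))) (hΔT : Δ ≤ T) :
    BddAbove (Set.range fun ε : Set.Icc (0 : ℝ) Δ =>
      ∫ y in (0 : ℝ)..((T : ℝ) - Δ), |h (y + ε) - h y|) := by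
  have hΔT' : (Δ : ℝ) ≤ T := hΔT
  have h0 : (0 : ℝ) ≤ (T : ℝ) - Δ := by linarith
  refine ⟨(∫ x in Set.Icc 0 (T : ℝ), |h x|) + ∫ x in Set.Icc 0 (T : ℝ), |h x|, ?_⟩
  rintro _ ⟨ε, rfl⟩
  have hsub : Set.Icc 0 ((T : ℝ) - Δ) ⊆ Set.Icc 0 (T : ℝ) :=
    Set.Icc_subset_Icc_right (by linarith [Δ.coe_nonneg])
  simp only
  rw [intervalIntegral.integral_of_le h0, ← integral_Icc_eq_integral_Ioc]
  calc ∫ y in Set.Icc 0 ((T : ℝ) - Δ), |h (y + ε) - h y|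
      ≤ ∫ y in Set.Icc 0 ((T : ℝ) - Δ), (|h (y + ε)| + |h y|) := by
        refine integral_mono (integrableOn_shift_sub hint ε.2).abs
          ((integrableOn_shift hint ε.2).abs.add (hint.mono_set hsub).abs) fun y => abs_sub _ _
    _ = (∫ y in Set.Icc 0 ((T : ℝ) - Δ), |h (y + ε)|) + ∫ y in Set.Icc 0 ((T : ℝ) - Δ), |h y| :=
        integral_add (integrableOn_shift hint ε.2).abs (hint.mono_set hsub).abs
    _ ≤ _ := by
        refine add_le_add ?_ (setIntegral_mono_set hint.abs
          (Filter.Eventually.of_forall fun x => abs_nonneg _) hsub.eventuallyLE)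
        have hpre : ∫ y in (fun x => x + (ε : ℝ)) ⁻¹' Set.Icc 0 (T : ℝ), |h (y + ε)| =
            ∫ x in Set.Icc 0 (T : ℝ), |h x| :=
          (measurePreserving_add_right volume (ε : ℝ)).setIntegral_preimage_emb
            (measurableEmbedding_addRight (ε : ℝ)) (fun x => |h x|) _
        rw [← hpre]
        refine setIntegral_mono_set ?_ (Filter.Eventually.of_forall fun x => abs_nonneg _)
          (Filter.Eventually.of_forall ?_)
        · exact (((measurePreserving_add_right volume (ε : ℝ)).integrableOn_comp_preimage
            (measurableEmbedding_addRight (ε : ℝ))).2 hint).abs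
        · intro x hx
          have hx' : x ∈ Set.Icc 0 ((T : ℝ) - Δ) := hx
          have hε := ε.2
          simp only [Set.mem_Icc] at hx' hε
          exact ⟨by linarith [hx'.1, hε.1], by linarith [hx'.2, hε.2]⟩

theorem lintegral_shiftModulus_le (hint : IntegrableOn h (Set.Icc 0 (T : ℝ))) (hΔT : Δ ≤ T)
    {ε : ℝ} (hε : ε ∈ Set.Icc 0 (Δ : ℝ)) :
    ∫⁻ x, shiftModulus h ((T : ℝ) - Δ) ε x ≤ ENNReal.ofReal
      (⨆ ε : Set.Icc (0 : ℝ) Δ, ∫ y in (0 : ℝ)..((T : ℝ) - Δ), |h (y + ε) - h y|) := by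
  have h0 : (0 : ℝ) ≤ (T : ℝ) - Δ := sub_nonneg.2 hΔT
  unfold shiftModulus
  rw [lintegral_indicator_Icc_enorm h0 (integrableOn_shift_sub hint hε)]
  exact ENNReal.ofReal_le_ofReal (le_ciSup (bddAbove_shift hint hΔT) ⟨ε, hε⟩)

/-- On a bounded interval the sampled kernel takes finitely many values, hence is bounded. -/
theorem integrableOn_grid (a : ℝ) :
    IntegrableOn (fun x : ℝ => h ((⌊x / (Δ : ℝ)⌋₊ : ℝ) * Δ + Δ)) (Set.Icc 0 a) := by
  refine Measure.integrableOn_of_bounded (M := ∑ k ∈ Finset.range (⌊a / (Δ : ℝ)⌋₊ + 1),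
    ‖h ((k : ℝ) * Δ + Δ)‖) (by simp) (measurable_grid h Δ).aestronglyMeasurable ?_
  refine (ae_restrict_iff' measurableSet_Icc).2 (Filter.Eventually.of_forall fun x hx => ?_)
  refine Finset.single_le_sum (f := fun k : ℕ => ‖h ((k : ℝ) * Δ + Δ)‖)
    (fun k _ => norm_nonneg _) ?_
  rw [Finset.mem_range, Nat.lt_succ_iff]
  exact Nat.floor_mono (div_le_div_of_nonneg_right hx.2 Δ.coe_nonneg)

theorem lintegral_gridModulus (hint : IntegrableOn h (Set.Icc 0 (T : ℝ))) (hΔT : Δ ≤ T) :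
    ∫⁻ x, gridModulus h Δ ((T : ℝ) - Δ) x = ENNReal.ofReal
      (∫ y in (0 : ℝ)..((T : ℝ) - Δ), |h y - h ((⌊y / (Δ : ℝ)⌋₊ : ℝ) * Δ + Δ)|) := by
  refine lintegral_indicator_Icc_enorm (sub_nonneg.2 hΔT) ((hint.mono_set ?_).sub
    (integrableOn_grid _))
  exact Set.Icc_subset_Icc_right (by linarith [Δ.coe_nonneg])

theorem ofReal_constR (hΔT : Δ ≤ T) : ENNReal.ofReal (constR T Δ h) =
    ENNReal.ofReal (∫ y in (0 : ℝ)..Δ, |h y|) + ENNReal.ofReal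
      (⨆ ε : Set.Icc (0 : ℝ) Δ, ∫ y in (0 : ℝ)..((T : ℝ) - Δ), |h (y + ε) - h y|) +
    ENNReal.ofReal
      (∫ y in (0 : ℝ)..((T : ℝ) - Δ), |h y - h ((⌊y / (Δ : ℝ)⌋₊ : ℝ) * Δ + Δ)|) := by
  have h0 : (0 : ℝ) ≤ (T : ℝ) - Δ := sub_nonneg.2 hΔT
  have h1 : 0 ≤ ∫ y in (0 : ℝ)..Δ, |h y| :=
    intervalIntegral.integral_nonneg Δ.coe_nonneg fun _ _ => abs_nonneg _
  have h2 : 0 ≤ ⨆ ε : Set.Icc (0 : ℝ) Δ, ∫ y in (0 : ℝ)..((T : ℝ) - Δ), |h (y + ε) - h y| :=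
    Real.iSup_nonneg fun _ => intervalIntegral.integral_nonneg h0 fun _ _ => abs_nonneg _
  have h3 : 0 ≤ ∫ y in (0 : ℝ)..((T : ℝ) - Δ), |h y - h ((⌊y / (Δ : ℝ)⌋₊ : ℝ) * Δ + Δ)| :=
    intervalIntegral.integral_nonneg h0 fun _ _ => abs_nonneg _
  rw [constR, ENNReal.ofReal_add (add_nonneg h1 h2) h3, ENNReal.ofReal_add h1 h2]

/-- Times r < s see h shifted by t - s ≤ Δ at the point s - r ≤ T - Δ; times s ≤ r < t see h only on
(0, Δ]. These are the first two terms of C_R. -/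
theorem lintegral_pastWeight_sub_le (hh : Measurable h) (hint : IntegrableOn h (Set.Icc 0 (T : ℝ)))
    (hΔT : Δ ≤ T) {s t : ℝ≥0} (hst : s ≤ t) (hts : t ≤ s + Δ) (hs : s + Δ ≤ T) :
    ∫⁻ r, ‖pastWeight h t r - pastWeight h s r‖ₑ ∂lebesgueNN ≤ ENNReal.ofReal (constR T Δ h) := by
  have hst' : (s : ℝ) ≤ t := hst
  have hts' : (t : ℝ) ≤ s + Δ := by exact_mod_cast hts
  have hs' : (s : ℝ) + Δ ≤ T := by exact_mod_cast hs
  have hm1 := measurable_absKernel hh Δ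
  have hm2 := measurable_shiftModulus hh ((T : ℝ) - Δ) ((t : ℝ) - s)
  have hle : ∀ r : ℝ≥0, ‖pastWeight h t r - pastWeight h s r‖ₑ ≤
      absKernel h Δ (t - r) + shiftModulus h ((T : ℝ) - Δ) ((t : ℝ) - s) ((s : ℝ) - r) := by
    intro r
    rcases lt_or_ge r s with h1 | h1
    · refine le_add_left ?_
      have h1' : (r : ℝ) < s := h1
      have hmem : (s : ℝ) - r ∈ Set.Icc 0 ((T : ℝ) - Δ) :=
        ⟨by linarith, by linarith [r.coe_nonneg]⟩
      rw [pastWeight, pastWeight, if_pos (h1.trans_le hst), if_pos h1, shiftModulus,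
        Set.indicator_of_mem hmem]
      apply le_of_eq
      congr 3
      ring
    · rw [pastWeight, pastWeight, if_neg (not_lt.2 h1), sub_zero]
      split_ifs with h2
      · refine le_add_right ?_
        have h1' : (s : ℝ) ≤ r := h1
        have h2' : (r : ℝ) < t := h2
        have hmem : (t : ℝ) - r ∈ Set.Ioc 0 (Δ : ℝ) := ⟨by linarith, by linarith⟩
        rw [absKernel, Set.indicator_of_mem hmem]
      · simp
  refine (lintegral_mono hle).trans ?_
  rw [lintegral_add_left (by fun_prop), ofReal_constR hΔT]
  refine le_add_right (add_le_add ?_ ?_)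
  · refine (lintegral_sub_left_le hm1 t).trans_eq (lintegral_absKernel (hint.mono_set ?_))
    exact Set.Icc_subset_Icc_right hΔT
  · refine (lintegral_sub_left_le hm2 s).trans (lintegral_shiftModulus_le hint hΔT ?_)
    exact ⟨by linarith, by linarith⟩

/-- Put z = nΔ - Δ - r. In the bins k < n the weights are h(z + Δ) and h((z)_Δ + Δ), so inserting
h(z) produces a shift by Δ and the grid error. In bin n only h on (0, Δ] remains. All three terms of
C_R occur. -/
theorem lintegral_pastWeight_sub_binWeight_le (hh : Measurable h)
    (hint : IntegrableOn h (Set.Icc 0 (T : ℝ))) (hΔ : 0 < Δ) (hΔT : Δ ≤ T) {n : ℕ}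
    (hn : (n : ℝ≥0) * Δ ≤ T) :
    ∫⁻ r, ‖pastWeight h (n * Δ) r - binWeight h Δ n r‖ₑ ∂lebesgueNN ≤
      ENNReal.ofReal (constR T Δ h) := by
  have hΔ' : (0 : ℝ) < Δ := hΔ
  have hn' : (n : ℝ) * Δ ≤ T := by exact_mod_cast hn
  have hm1 := measurable_absKernel hh Δ
  have hm2 := measurable_shiftModulus hh ((T : ℝ) - Δ) Δ
  have hm3 := measurable_gridModulus hh Δ ((T : ℝ) - Δ)
  -- Time 0 belongs to no bin, since bins are open on the left.
  have hae : ∀ᵐ r ∂lebesgueNN, r ≠ 0 :=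
    measure_eq_zero_iff_ae_notMem.1 (lebesgueNN_singleton 0)
  have hle : ∀ r : ℝ≥0, r ≠ 0 → ‖pastWeight h (n * Δ) r - binWeight h Δ n r‖ₑ ≤
      absKernel h Δ ((n : ℝ) * Δ - r) +
        shiftModulus h ((T : ℝ) - Δ) Δ ((n : ℝ) * Δ - Δ - r) +
        gridModulus h Δ ((T : ℝ) - Δ) ((n : ℝ) * Δ - Δ - r) := by
    intro r hr
    have hr0 : 0 < r := pos_iff_ne_zero.2 hr
    have hr0' : (0 : ℝ) < r := hr0
    have hk1 : 1 ≤ ⌈r / Δ⌉₊ := Nat.one_le_iff_ne_zero.2 (Nat.ceil_pos.2 (div_pos hr0 hΔ)).ne'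
    obtain ⟨k, hk⟩ : ∃ k, k = ⌈r / Δ⌉₊ := ⟨_, rfl⟩
    have hbin := (mem_bin_iff hΔ hk1 r).2 rfl
    rw [← hk] at hbin hk1
    have hb1 : ((k : ℝ) - 1) * Δ < r := by
      have : (((k - 1 : ℕ) : ℝ≥0) : ℝ) * Δ < r := by exact_mod_cast hbin.1
      rwa [NNReal.coe_natCast, Nat.cast_sub hk1, Nat.cast_one] at this
    have hb2 : (r : ℝ) ≤ k * Δ := by exact_mod_cast hbin.2
    rcases lt_or_ge k n with hkn | hkn
    · have hkn' : (k : ℝ) + 1 ≤ n := by exact_mod_cast hkn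
      have hlt : (r : ℝ) < n * Δ := by nlinarith
      have hlt' : r < n * Δ := by exact_mod_cast hlt
      have hz0 : 0 ≤ (n : ℝ) * Δ - Δ - r := by nlinarith
      have hz : (n : ℝ) * Δ - Δ - r ∈ Set.Icc 0 ((T : ℝ) - Δ) := ⟨hz0, by linarith⟩
      -- Bins are closed on the right, so reflecting time gives z/Δ ∈ [n - k - 1, n - k), on which
      -- the floor is constant.
      have hfl : ⌊((n : ℝ) * Δ - Δ - r) / Δ⌋₊ = n - k - 1 := by
        rw [Nat.floor_eq_iff (div_nonneg hz0 hΔ'.le), le_div_iff₀ hΔ', div_lt_iff₀ hΔ']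
        have : ((n - k - 1 : ℕ) : ℝ) = n - k - 1 := by
          rw [Nat.cast_sub (by omega), Nat.cast_sub hkn.le, Nat.cast_one]
        rw [this]
        constructor <;> nlinarith
      rw [pastWeight, if_pos hlt', binWeight, ← hk, if_pos ⟨hk1, hkn⟩, shiftModulus,
        Set.indicator_of_mem hz, gridModulus, Set.indicator_of_mem hz, hfl, add_assoc]
      refine le_add_left ?_
      have e1 : (n : ℝ) * Δ - Δ - r + Δ = ((n * Δ : ℝ≥0) : ℝ) - r := by push_cast; ring
      have e2 : ((n - k - 1 : ℕ) : ℝ) * Δ + Δ = ((n - k : ℕ) : ℝ) * Δ := by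
        rw [Nat.cast_sub (by omega : 1 ≤ n - k)]; push_cast; ring
      rw [e1, e2]
      refine le_trans (le_of_eq ?_) (enorm_add_le _ _)
      congr 1
      ring
    · rw [binWeight, ← hk, if_neg (by omega), sub_zero, pastWeight]
      split_ifs with h1
      · have h1' : (r : ℝ) < n * Δ := by exact_mod_cast h1
        have hkn' : (n : ℝ) ≤ k := by exact_mod_cast hkn
        rw [add_assoc]
        refine le_add_right ?_
        have hmem : (n : ℝ) * Δ - r ∈ Set.Ioc 0 (Δ : ℝ) := ⟨by linarith, by nlinarith⟩
        rw [absKernel, Set.indicator_of_mem hmem]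
        simp
      · simp
  refine (lintegral_mono_ae (hae.mono hle)).trans ?_
  rw [lintegral_add_left (by fun_prop), lintegral_add_left (by fun_prop), ofReal_constR hΔT]
  refine add_le_add (add_le_add ?_ ?_) ?_
  · refine (lintegral_sub_left_le hm1 _).trans_eq (lintegral_absKernel (hint.mono_set ?_))
    exact Set.Icc_subset_Icc_right hΔT
  · refine (lintegral_sub_left_le hm2 _).trans (lintegral_shiftModulus_le hint hΔT ?_)
    exact ⟨hΔ'.le, le_rfl⟩
  · exact (lintegral_sub_left_le hm3 _).trans_eq (lintegral_gridModulus hint hΔT)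

end Modulus

/-! ### Pathwise representation of the intensities -/

/-- The real valued indicator of `θ ≤ l`. -/
noncomputable def belowReal (l : ℝ) (θ : ℝ≥0) : ℝ := if (θ : ℝ) ≤ l then 1 else 0

theorem measurable_belowReal {X : Type*} [MeasurableSpace X] {l : X → ℝ} {θ : X → ℝ≥0}
    (hl : Measurable l) (hθ : Measurable θ) : Measurable fun x => belowReal (l x) (θ x) :=
  Measurable.ite (measurableSet_le hθ.coe_nnreal_real hl) measurable_const measurable_const

theorem enorm_mul_belowReal (w l : ℝ) (θ : ℝ≥0) {c : ℝ} (hc : 0 ≤ c) :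
    ‖w * belowReal l θ * c‖ₑ = ‖w‖ₑ * below l θ * ENNReal.ofReal c := by
  rw [enorm_mul, enorm_mul, Real.enorm_eq_ofReal hc]
  congr 2
  rw [belowReal, below]
  split_ifs <;> simp

theorem enorm_belowReal_sub (l l' : ℝ) (θ : ℝ≥0) :
    ‖belowReal l θ - belowReal l' θ‖ₑ = between l l' θ := by
  rw [belowReal, belowReal, between]
  by_cases h1 : (θ : ℝ) ≤ l <;> by_cases h2 : (θ : ℝ) ≤ l' <;>
    simp [h1, h2, not_le.1, not_lt.2]

/-- The order of the splitting matters: the weight error keeps the threshold l, later λ with its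
bounded mean, and the threshold error keeps the weight w', later the grid weights that sum to
ρ_{h,Δ}. -/
theorem enorm_mul_belowReal_sub_le (w w' l l' : ℝ) (θ : ℝ≥0) {c : ℝ} (hc : 0 ≤ c) :
    ‖w * belowReal l θ * c - w' * belowReal l' θ * c‖ₑ ≤
      ‖w - w'‖ₑ * below l θ * ENNReal.ofReal c +
        ‖w'‖ₑ * between l l' θ * ENNReal.ofReal c := by
  have : w * belowReal l θ * c - w' * belowReal l' θ * c =
      (w - w') * belowReal l θ * c + w' * (belowReal l θ - belowReal l' θ) * c := by ring
  rw [this]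
  refine (enorm_add_le _ _).trans_eq ?_
  rw [enorm_mul_belowReal _ _ _ hc, enorm_mul, enorm_mul, enorm_belowReal_sub,
    Real.enorm_eq_ofReal hc]

theorem ofReal_lipschitz_integral_le {E : Type*} [MeasurableSpace E] {m : Measure E} {L : ℝ≥0}
    {ψ : ℝ → ℝ} (hψ : LipschitzWith L ψ) {f g : E → ℝ} (hf : Integrable f m)
    (hg : Integrable g m) :
    ENNReal.ofReal |ψ (∫ x, f x ∂m) - ψ (∫ x, g x ∂m)| ≤ L * ∫⁻ x, ‖f x - g x‖ₑ ∂m := by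
  refine (ofReal_lipschitz_le hψ _ _).trans ?_
  rw [← integral_sub hf hg]
  gcongr
  exact enorm_integral_le_lintegral_enorm _

theorem IsPointMeasure.integrable_of_support {E : Type*} [MeasurableSpace E] {m : Measure E}
    (hm : IsPointMeasure m) {S : Set E} (hS : MeasurableSet S) (hfin : m S < ∞) {f : E → ℝ}
    (hf : Measurable f) (hfS : Function.support f ⊆ S) : Integrable f m := by
  rw [← integrableOn_iff_integrable_of_support_subset hfS]
  exact ⟨hf.aestronglyMeasurable,
    hm.setLIntegral_lt_top hS hfin hf.enorm fun x => enorm_ne_top⟩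

theorem measurable_weighted {w l : ℝ≥0 → ℝ} {b : ℝ → ℝ} (hw : Measurable w) (hl : Measurable l)
    (hb : Measurable b) :
    Measurable fun p : Pt => w p.1 * belowReal (l p.1) p.2.1 * b p.2.2 := by
  have := measurable_belowReal (hl.comp measurable_fst)
    (measurable_fst.comp measurable_snd : Measurable fun p : Pt => p.2.1)
  simp only [Function.comp_def] at this
  fun_prop

theorem integrable_pastWeight {T t : ℝ≥0} {h b : ℝ → ℝ} {l : ℝ≥0 → ℝ} {m : Measure Pt}
    (hm : IsPointMeasure m) (hh : Measurable h) (hb : Measurable b) (hl : Measurable l)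
    (hfin : m {p : Pt | p.1 ≤ T ∧ (p.2.1 : ℝ) ≤ l p.1} < ∞) (ht : t ≤ T) :
    Integrable (fun p : Pt => pastWeight h t p.1 * belowReal (l p.1) p.2.1 * b p.2.2) m := by
  refine hm.integrable_of_support (measurableSet_thinned hl (measurableSet_Iic (a := T))) hfin
    (measurable_weighted (measurable_pastWeight hh t) hl hb) fun p hp => ?_
  rw [Function.mem_support] at hp
  refine ⟨?_, ?_⟩
  · by_contra hc
    refine hp ?_
    have : ¬ p.1 < t := fun h' => hc (h'.le.trans ht)
    rw [pastWeight, if_neg this, zero_mul, zero_mul]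
  · by_contra hc
    exact hp (by rw [belowReal, if_neg hc, mul_zero, zero_mul])

theorem setIntegral_eq_integral_pastWeight {t : ℝ≥0} {h b : ℝ → ℝ} {l : ℝ≥0 → ℝ}
    (hl : Measurable l) (m : Measure Pt) :
    ∫ p in {p : Pt | p.1 < t ∧ (p.2.1 : ℝ) ≤ l p.1}, h ((t : ℝ) - (p.1 : ℝ)) * b p.2.2 ∂m =
      ∫ p, pastWeight h t p.1 * belowReal (l p.1) p.2.1 * b p.2.2 ∂m := by
  have hS : MeasurableSet {p : Pt | p.1 < t ∧ (p.2.1 : ℝ) ≤ l p.1} :=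
    measurableSet_thinned hl measurableSet_Iio
  rw [← integral_indicator hS]
  congr 1; ext p
  by_cases h1 : p.1 < t <;> by_cases h2 : (p.2.1 : ℝ) ≤ l p.1 <;>
    simp [pastWeight, belowReal, h1, h2]

/-- The bins are disjoint, so at most one summand survives. The discrete recursion thereby becomes a
single integral against the same points as the continuous equation. -/
theorem binWeight_eq_sum {h b : ℝ → ℝ} {Δ : ℝ≥0} (hΔ : 0 < Δ) (n : ℕ) (l : ℕ → ℝ) (p : Pt) :
    binWeight h Δ n p.1 * belowReal (l ⌈p.1 / Δ⌉₊) p.2.1 * b p.2.2 =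
      ∑ k ∈ Finset.Ico 1 n, h (((n - k : ℕ) : ℝ) * Δ) *
        Set.indicator {p : Pt | p.1 ∈ Set.Ioc (((k - 1 : ℕ) : ℝ≥0) * Δ) ((k : ℝ≥0) * Δ) ∧
          (p.2.1 : ℝ) ≤ l k} (fun p => b p.2.2) p := by
  have hmem : ∀ k ∈ Finset.Ico 1 n, p.1 ∈ Set.Ioc (((k - 1 : ℕ) : ℝ≥0) * Δ) ((k : ℝ≥0) * Δ) ↔
      ⌈p.1 / Δ⌉₊ = k := fun k hk => mem_bin_iff hΔ (Finset.mem_Ico.1 hk).1 p.1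
  obtain ⟨j, hj⟩ : ∃ j, j = ⌈p.1 / Δ⌉₊ := ⟨_, rfl⟩
  rw [← hj] at hmem ⊢
  rw [binWeight, ← hj]
  by_cases hjn : 1 ≤ j ∧ j < n
  · have hjm : j ∈ Finset.Ico 1 n := Finset.mem_Ico.2 hjn
    rw [Finset.sum_eq_single_of_mem j hjm, if_pos hjn]
    · by_cases hl : (p.2.1 : ℝ) ≤ l j
      · have hp : p ∈ {p : Pt | p.1 ∈ Set.Ioc (((j - 1 : ℕ) : ℝ≥0) * Δ) ((j : ℝ≥0) * Δ) ∧
            (p.2.1 : ℝ) ≤ l j} := ⟨(hmem j hjm).2 rfl, hl⟩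
        rw [Set.indicator_of_mem hp, belowReal, if_pos hl,
          mul_one]
      · rw [Set.indicator_of_notMem (fun hp => hl hp.2), belowReal, if_neg hl]
        ring
    · intro k hk hkj
      rw [Set.indicator_of_notMem, mul_zero]
      exact fun hp => hkj ((hmem k hk).1 hp.1).symm
  · rw [if_neg hjn, zero_mul, zero_mul, Finset.sum_eq_zero]
    intro k hk
    rw [Set.indicator_of_notMem, mul_zero]
    intro hp
    rw [(hmem k hk).1 hp.1] at hjn
    exact hjn (Finset.mem_Ico.1 hk)

theorem measurableSet_bin (Δ : ℝ≥0) (k : ℕ) (l : ℝ) :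
    MeasurableSet {p : Pt | p.1 ∈ Set.Ioc (((k - 1 : ℕ) : ℝ≥0) * Δ) ((k : ℝ≥0) * Δ) ∧
      (p.2.1 : ℝ) ≤ l} :=
  measurableSet_thinned measurable_const measurableSet_Ioc

theorem integrable_indicator_bin {b : ℝ → ℝ} {m : Measure Pt} (hm : IsPointMeasure m)
    (hbox : ∀ N, m (box N) < ∞) (hb : Measurable b) (Δ : ℝ≥0) (k : ℕ) (l : ℝ) :
    Integrable (Set.indicator {p : Pt | p.1 ∈ Set.Ioc (((k - 1 : ℕ) : ℝ≥0) * Δ) ((k : ℝ≥0) * Δ) ∧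
      (p.2.1 : ℝ) ≤ l} (fun p => b p.2.2)) m := by
  obtain ⟨N, hN⟩ := exists_nat_ge (max ((k : ℝ≥0) * Δ) l.toNNReal)
  refine hm.integrable_of_support (measurableSet_box N) (hbox N)
    (Measurable.indicator (by fun_prop) (measurableSet_bin Δ k l)) ?_
  refine Set.support_indicator_subset.trans fun p hp => ⟨?_, ?_, trivial⟩
  · exact hp.1.2.trans ((le_max_left _ _).trans hN)
  · exact (NNReal.le_toNNReal_of_coe_le hp.2).trans ((le_max_right _ _).trans hN)

theorem integrable_binWeight {h b : ℝ → ℝ} {m : Measure Pt} (hm : IsPointMeasure m)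
    (hbox : ∀ N, m (box N) < ∞) (hb : Measurable b) {Δ : ℝ≥0} (hΔ : 0 < Δ) (n : ℕ) (l : ℕ → ℝ) :
    Integrable (fun p : Pt => binWeight h Δ n p.1 * belowReal (l ⌈p.1 / Δ⌉₊) p.2.1 * b p.2.2)
      m := by
  simp only [binWeight_eq_sum hΔ]
  exact integrable_finsetSum _ fun k _ =>
    (integrable_indicator_bin hm hbox hb Δ k (l k)).const_mul _

theorem sum_binMass_eq_integral {h b : ℝ → ℝ} {m : Measure Pt} (hm : IsPointMeasure m)
    (hbox : ∀ N, m (box N) < ∞) (hb : Measurable b) {Δ : ℝ≥0} (hΔ : 0 < Δ) (n : ℕ) (l : ℕ → ℝ) :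
    ∑ k ∈ Finset.Ico 1 n, h (((n - k : ℕ) : ℝ) * Δ) * binMass m b Δ k (l k) =
      ∫ p, binWeight h Δ n p.1 * belowReal (l ⌈p.1 / Δ⌉₊) p.2.1 * b p.2.2 ∂m := by
  simp only [binWeight_eq_sum hΔ]
  rw [integral_finsetSum _ fun k _ =>
    (integrable_indicator_bin hm hbox hb Δ k (l k)).const_mul _]
  refine Finset.sum_congr rfl fun k _ => ?_
  rw [integral_const_mul, integral_indicator (measurableSet_bin Δ k (l k))]
  rfl

/-! ### Mean increments of the continuous intensity -/

section Discretisation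

variable {Ω : Type*} [mΩ : MeasurableSpace Ω] {Pr : Measure Ω} [IsProbabilityMeasure Pr]
  {ν : Measure ℝ} [IsProbabilityMeasure ν] {P : Ω → Measure Pt} {T Δ : ℝ≥0} {h ψ b : ℝ → ℝ}
  {L : ℝ≥0} {lam : ℝ≥0 → Ω → ℝ}

theorem IsPoissonRandomMeasure.lintegral_below_intensity_le
    (hP : IsPoissonRandomMeasure Pr (intensityMeasure ν) P)
    (hlam : IsHawkesIntensity Pr P hP.measurable T h ψ b lam) (hb : Measurable b) {C : ℝ≥0∞}
    (hC : ∀ t ≤ T, ∫⁻ ω, ENNReal.ofReal (lam t ω) ∂Pr ≤ C) {w : ℝ≥0 → ℝ≥0∞} (hw : Measurable w)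
    (hwT : ∀ r, T < r → w r = 0) :
    ∫⁻ ω, ∫⁻ p, w p.1 * below (lam p.1 ω) p.2.1 * ENNReal.ofReal (b p.2.2) ∂P ω ∂Pr ≤
      meanMark ν b * C * ∫⁻ r, w r ∂lebesgueNN := by
  have hlm := measurable_uncurry_of_predictable hlam.predictable
  refine (hP.lintegral_below_le (w := fun x => w x.1) (l := fun x => lam x.1 x.2) hb
    (hw.comp measurable_fst_predictable)
    (isStronglyPredictable_measurable hlam.predictable)).trans ?_
  rw [mul_assoc]
  gcongr
  rw [← lintegral_const_mul _ hw]
  refine lintegral_mono fun r => ?_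
  have hlr : Measurable (lam r) := hlm.comp (f := fun ω => (r, ω)) measurable_prodMk_left
  simp only
  rw [lintegral_const_mul _ hlr.ennreal_ofReal, mul_comm]
  rcases le_or_gt r T with hr | hr
  · gcongr
    exact hC r hr
  · rw [hwT r hr]; simp

/-- Both times thin with the same threshold λ, so only the weights differ, and compensation replaces
the accepted points by a density of mean at most `C`. -/
theorem IsHawkesIntensity.lintegral_sub_le
    (hP : IsPoissonRandomMeasure Pr (intensityMeasure ν) P)
    (hlam : IsHawkesIntensity Pr P hP.measurable T h ψ b lam) (hψ : LipschitzWith L ψ)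
    (hb_nonneg : ∀ y, 0 ≤ b y) (hb : Measurable b) (hh : Measurable h) {C : ℝ≥0∞}
    (hC : ∀ t ≤ T, ∫⁻ ω, ENNReal.ofReal (lam t ω) ∂Pr ≤ C) {s t : ℝ≥0} (hs : s ≤ T) (ht : t ≤ T) :
    ∫⁻ ω, ENNReal.ofReal |lam t ω - lam s ω| ∂Pr ≤
      L * meanMark ν b * C * ∫⁻ r, ‖pastWeight h t r - pastWeight h s r‖ₑ ∂lebesgueNN := by
  have hw : Measurable fun r => ‖pastWeight h t r - pastWeight h s r‖ₑ :=
    ((measurable_pastWeight hh t).sub (measurable_pastWeight hh s)).enorm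
  calc ∫⁻ ω, ENNReal.ofReal |lam t ω - lam s ω| ∂Pr
      ≤ ∫⁻ ω, L * ∫⁻ p, ‖pastWeight h t p.1 - pastWeight h s p.1‖ₑ * below (lam p.1 ω) p.2.1 *
          ENNReal.ofReal (b p.2.2) ∂P ω ∂Pr := by
        refine lintegral_mono_ae ?_
        filter_upwards [hlam.nonexplosive, hlam.equation] with ω hfin heq
        have hl := measurable_path_of_predictable hlam.predictable ω
        rw [heq t ht, heq s hs, setIntegral_eq_integral_pastWeight hl,
          setIntegral_eq_integral_pastWeight hl]
        refine (ofReal_lipschitz_integral_le hψ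
          (integrable_pastWeight (hP.isPointMeasure ω) hh hb hl hfin ht)
          (integrable_pastWeight (hP.isPointMeasure ω) hh hb hl hfin hs)).trans ?_
        gcongr with p
        rw [← sub_mul, ← sub_mul, enorm_mul_belowReal _ _ _ (hb_nonneg _)]
    _ ≤ L * (meanMark ν b * C * ∫⁻ r, ‖pastWeight h t r - pastWeight h s r‖ₑ ∂lebesgueNN) := by
        rw [lintegral_const_mul' _ _ ENNReal.coe_ne_top]
        gcongr
        refine hP.lintegral_below_intensity_le hlam hb hC hw fun r hr => ?_
        rw [pastWeight, pastWeight, if_neg (not_lt.2 (ht.trans hr.le)),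
          if_neg (not_lt.2 (hs.trans hr.le))]
        simp
    _ = _ := by rw [← mul_assoc, ← mul_assoc]

/-! ### Measurability of the discrete intensity -/

theorem measurable_naturalFiltration (hP : Measurable P) {t : ℝ≥0} {A : Set Pt}
    (hA : MeasurableSet A) (hAt : ∀ p ∈ A, p.1 ∈ Set.Ioc 0 t) :
    Measurable[naturalFiltration P hP t] fun ω => P ω A :=
  measurable_iff_comap_le.2 (le_iSup₂_of_le (f := fun A (_ : A ∈ {A : Set Pt | MeasurableSet A ∧
    ∀ p ∈ A, p.1 ∈ Set.Ioc 0 t}) => MeasurableSpace.comap (fun ω => P ω A) inferInstance)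
    A ⟨hA, hAt⟩ le_rfl)

theorem binMass_eq_toReal (m : Measure Pt) (hb_nonneg : ∀ y, 0 ≤ b y) (hb : Measurable b) (k : ℕ)
    (l : ℝ) : binMass m b Δ k l =
      (∫⁻ p, below l p.2.1 * ENNReal.ofReal (b p.2.2)
        ∂(m.restrict {p | p.1 ∈ Set.Ioc (((k - 1 : ℕ) : ℝ≥0) * Δ) ((k : ℝ≥0) * Δ)})).toReal := by
  have hI : MeasurableSet {p : Pt | p.1 ∈ Set.Ioc (((k - 1 : ℕ) : ℝ≥0) * Δ) ((k : ℝ≥0) * Δ)} :=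
    measurable_fst measurableSet_Ioc
  rw [binMass, integral_eq_lintegral_of_nonneg_ae
    (Filter.Eventually.of_forall fun p => hb_nonneg _)
    (show Measurable fun p : Pt => b p.2.2 by fun_prop).aestronglyMeasurable,
    ← lintegral_indicator (measurableSet_bin Δ k l), ← lintegral_indicator hI]
  congr 2; ext p
  simp only [Set.indicator_apply, Set.mem_ofPred_eq, below]
  by_cases h1 : p.1 ∈ Set.Ioc (((k - 1 : ℕ) : ℝ≥0) * Δ) ((k : ℝ≥0) * Δ) <;>
    by_cases h2 : (p.2.1 : ℝ) ≤ l <;> simp [h2]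

omit [IsProbabilityMeasure Pr] in
-- The restriction of `P` to the bin is a random measure measurable at time kΔ, with an s-finite
-- kernel version for that σ-algebra. Equality holds only almost surely because the filtration is
-- not completed.
theorem IsPoissonRandomMeasure.exists_measurable_binMass
    (hP : IsPoissonRandomMeasure Pr (intensityMeasure ν) P) (hb_nonneg : ∀ y, 0 ≤ b y)
    (hb : Measurable b) (k : ℕ) {l : Ω → ℝ}
    (hl : Measurable[naturalFiltration P hP.measurable (k * Δ)] l) :
    ∃ X : Ω → ℝ, Measurable[naturalFiltration P hP.measurable (k * Δ)] X ∧
      ∀ᵐ ω ∂Pr, X ω = binMass (P ω) b Δ k (l ω) := by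
  set I : Set Pt := {p : Pt | p.1 ∈ Set.Ioc (((k - 1 : ℕ) : ℝ≥0) * Δ) ((k : ℝ≥0) * Δ)} with hIdef
  have hI : MeasurableSet I := measurable_fst measurableSet_Ioc
  have hQ : Measurable[naturalFiltration P hP.measurable (k * Δ)]
      fun ω => (P ω).restrict I := by
    refine @Measure.measurable_of_measurable_coe _ _ _
      (naturalFiltration P hP.measurable (k * Δ)) _ fun A hA => ?_
    simp only [Measure.restrict_apply hA]
    exact measurable_naturalFiltration hP.measurable (hA.inter hI) fun p hp =>
      ⟨zero_le.trans_lt hp.2.1, hp.2.2⟩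
  obtain ⟨κ, hκ, hκP⟩ := @exists_isSFiniteKernel_eq _ _
    (naturalFiltration P hP.measurable (k * Δ)) _ _ hQ _ measurableSet_box iUnion_box
  refine ⟨fun ω => (∫⁻ p, below (l ω) p.2.1 * ENNReal.ofReal (b p.2.2) ∂κ ω).toReal, ?_, ?_⟩
  · refine Measurable.ennreal_toReal ?_
    refine @Measurable.lintegral_kernel_prod_right _ _ (naturalFiltration P hP.measurable (k * Δ))
      _ κ hκ (fun ω p => below (l ω) p.2.1 * ENNReal.ofReal (b p.2.2)) ?_
    let _ : MeasurableSpace Ω := naturalFiltration P hP.measurable (k * Δ)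
    exact (measurable_below (hl.comp measurable_fst)
      (measurable_fst.comp (measurable_snd.comp measurable_snd))).mul (by fun_prop)
  · filter_upwards [hP.ae_box_lt_top] with ω hω
    rw [binMass_eq_toReal _ hb_nonneg hb, hκP ω fun n =>
      (Measure.restrict_apply_le _ _).trans_lt (hω n)]

omit [IsProbabilityMeasure Pr] in
-- The recursion for l_n stops at bin n - 1, so l_n is known at the left end of bin n; this one-step
-- delay is the source of predictability.
theorem IsPoissonRandomMeasure.exists_measurable_discIntensity
    (hP : IsPoissonRandomMeasure Pr (intensityMeasure ν) P) (hψ : LipschitzWith L ψ)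
    (hb_nonneg : ∀ y, 0 ≤ b y) (hb : Measurable b) (n : ℕ) :
    ∃ l : Ω → ℝ, Measurable[naturalFiltration P hP.measurable ((n - 1 : ℕ) * Δ)] l ∧
      ∀ᵐ ω ∂Pr, l ω = discIntensity (P ω) h ψ b Δ n := by
  induction n using Nat.strong_induction_on with
  | _ n ih =>
    have hX : ∀ k : ℕ, ∃ X : Ω → ℝ, k ∈ Finset.Ico 1 n →
        Measurable[naturalFiltration P hP.measurable ((n - 1 : ℕ) * Δ)] X ∧
        ∀ᵐ ω ∂Pr, X ω = binMass (P ω) b Δ k (discIntensity (P ω) h ψ b Δ k) := by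
      intro k
      by_cases hk : k ∈ Finset.Ico 1 n
      swap
      · exact ⟨0, fun h' => absurd h' hk⟩
      have hkn := Finset.mem_Ico.1 hk
      obtain ⟨l, hl, hle⟩ := ih k hkn.2
      obtain ⟨X, hX, hXe⟩ := hP.exists_measurable_binMass (Δ := Δ) hb_nonneg hb k
        (hl.mono ((naturalFiltration P hP.measurable).mono (by gcongr; omega)) le_rfl)
      refine ⟨X, fun _ => ⟨hX.mono ((naturalFiltration P hP.measurable).mono
        (by gcongr; omega)) le_rfl, ?_⟩⟩
      filter_upwards [hle, hXe] with ω h1 h2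
      rw [h2, h1]
    choose X hX using hX
    refine ⟨fun ω => ψ (∑ k ∈ Finset.Ico 1 n, h (((n - k : ℕ) : ℝ) * Δ) * X k ω), ?_, ?_⟩
    · refine hψ.continuous.measurable.comp (Finset.measurable_fun_sum _ fun k hk => ?_)
      exact (hX k hk).1.const_mul _
    · have hall : ∀ᵐ ω ∂Pr, ∀ k ∈ Finset.Ico 1 n,
          X k ω = binMass (P ω) b Δ k (discIntensity (P ω) h ψ b Δ k) :=
        (Finset.eventually_all _).2 fun k hk => (hX k hk).2
      filter_upwards [hall] with ω hω
      rw [discIntensity_eq]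
      congr 1
      exact Finset.sum_congr rfl fun k hk => by rw [hω k hk]

/-- On ((k - 1)Δ, kΔ] the process is l_k, known at the open left end, so each bin yields a
predictable rectangle; the index 0 corresponds to {0}. -/
theorem measurable_step_predictable {F : Filtration ℝ≥0 mΩ} (hΔ : 0 < Δ) {l : ℕ → Ω → ℝ}
    (hl : ∀ n, Measurable[F ((n - 1 : ℕ) * Δ)] (l n)) :
    Measurable[F.predictable] fun x : ℝ≥0 × Ω => l ⌈x.1 / Δ⌉₊ x.2 := by
  intro B hB
  have : (fun x : ℝ≥0 × Ω => l ⌈x.1 / Δ⌉₊ x.2) ⁻¹' B =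
      ⋃ k : ℕ, {s : ℝ≥0 | ⌈s / Δ⌉₊ = k} ×ˢ (l k ⁻¹' B) := by
    ext x; simp
  rw [this]
  refine MeasurableSet.iUnion fun k => ?_
  rcases Nat.eq_zero_or_pos k with rfl | hk
  · have h0 : {s : ℝ≥0 | ⌈s / Δ⌉₊ = 0} = {⊥} := by
      ext s
      simp [hΔ.ne']
    rw [h0]
    exact measurableSet_predictable_singleton_bot_prod
      (F.mono (by simp) _ (hl 0 hB))
  · have h0 : {s : ℝ≥0 | ⌈s / Δ⌉₊ = k} =
        Set.Ioc (((k - 1 : ℕ) : ℝ≥0) * Δ) ((k : ℝ≥0) * Δ) := by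
      ext s
      exact (mem_bin_iff hΔ hk s).symm
    rw [h0]
    exact measurableSet_predictable_Ioc_prod _ _ (hl k hB)

end Discretisation

/-! ### Comparison of the intensities -/

section Comparison

variable {Ω : Type*} [mΩ : MeasurableSpace Ω] {Pr : Measure Ω} [IsProbabilityMeasure Pr]
  {ν : Measure ℝ} [IsProbabilityMeasure ν] {P : Ω → Measure Pt} {T Δ : ℝ≥0} {h ψ b : ℝ → ℝ}
  {L : ℝ≥0} {lam : ℝ≥0 → Ω → ℝ} {l : ℕ → Ω → ℝ}

theorem lebesgueNN_bin_le (hΔ : 0 < Δ) {k : ℕ} (hk : 1 ≤ k) :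
    lebesgueNN {s : ℝ≥0 | ⌈s / Δ⌉₊ = k} ≤ Δ := by
  have h0 : {s : ℝ≥0 | ⌈s / Δ⌉₊ = k} = {s : ℝ≥0 |
      (s : ℝ) ∈ Set.Ioc (((k - 1 : ℕ) : ℝ) * Δ) ((k : ℝ) * Δ)} := by
    ext s
    simp only [Set.mem_ofPred_eq]
    rw [← mem_bin_iff hΔ hk s, Set.mem_Ioc, Set.mem_Ioc, ← NNReal.coe_lt_coe, ← NNReal.coe_le_coe,
      NNReal.coe_mul, NNReal.coe_mul, NNReal.coe_natCast, NNReal.coe_natCast]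
  rw [h0, lebesgueNN_preimage_coe_le _ measurableSet_Ioc]
  refine (measure_mono Set.inter_subset_left).trans ?_
  rw [Real.volume_Ioc, ← sub_mul, Nat.cast_sub hk]
  simp

theorem lintegral_binWeight_mul_le (hΔ : 0 < Δ) (n : ℕ) {V : ℕ → ℝ≥0∞} :
    ∫⁻ s, ‖binWeight h Δ n s‖ₑ * V ⌈s / Δ⌉₊ ∂lebesgueNN ≤
      ∑ k ∈ Finset.Ico 1 n, ‖h (((n - k : ℕ) : ℝ) * Δ)‖ₑ * V k * Δ := by
  have hm : ∀ k, MeasurableSet {s : ℝ≥0 | ⌈s / Δ⌉₊ = k} := fun k =>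
    (Nat.measurable_ceil.comp (measurable_id.div_const Δ)) (measurableSet_singleton k)
  calc ∫⁻ s, ‖binWeight h Δ n s‖ₑ * V ⌈s / Δ⌉₊ ∂lebesgueNN
      = ∫⁻ s, ∑ k ∈ Finset.Ico 1 n, Set.indicator {s : ℝ≥0 | ⌈s / Δ⌉₊ = k}
          (fun _ => ‖h (((n - k : ℕ) : ℝ) * Δ)‖ₑ * V k) s ∂lebesgueNN := by
        refine lintegral_congr fun s => ?_
        simp only [Set.indicator_apply, Set.mem_ofPred_eq]
        rw [Finset.sum_ite_eq, binWeight]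
        simp only [Finset.mem_Ico]
        split_ifs <;> simp
    _ = ∑ k ∈ Finset.Ico 1 n, ‖h (((n - k : ℕ) : ℝ) * Δ)‖ₑ * V k *
          lebesgueNN {s : ℝ≥0 | ⌈s / Δ⌉₊ = k} := by
        rw [lintegral_finsetSum _ fun k _ => measurable_const.indicator (hm k)]
        exact Finset.sum_congr rfl fun k _ => lintegral_indicator_const (hm k) _
    _ ≤ _ := by
        refine Finset.sum_le_sum fun k hk => ?_
        gcongr
        exact lebesgueNN_bin_le hΔ (Finset.mem_Ico.1 hk).1

/-- This is one step of the recursion for the error: the first term pays for sampling the kernel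
under the threshold λ, the second for replacing λ_s by l_k, where `V k` bounds the mean gap
throughout bin k. -/
theorem IsHawkesIntensity.lintegral_sub_disc_le
    (hP : IsPoissonRandomMeasure Pr (intensityMeasure ν) P)
    (hlam : IsHawkesIntensity Pr P hP.measurable T h ψ b lam) (hψ : LipschitzWith L ψ)
    (hb_nonneg : ∀ y, 0 ≤ b y) (hb : Measurable b) (hh : Measurable h)
    (hint : IntegrableOn h (Set.Icc 0 (T : ℝ))) {C : ℝ≥0∞}
    (hC : ∀ t ≤ T, ∫⁻ ω, ENNReal.ofReal (lam t ω) ∂Pr ≤ C) (hΔ : 0 < Δ) (hΔT : Δ ≤ T)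
    (hl : ∀ n, Measurable[naturalFiltration P hP.measurable ((n - 1 : ℕ) * Δ)] (l n))
    (hle : ∀ n, ∀ᵐ ω ∂Pr, l n ω = discIntensity (P ω) h ψ b Δ n) {n : ℕ}
    (hn : (n : ℝ≥0) * Δ ≤ T) {V : ℕ → ℝ≥0∞}
    (hV : ∀ s : ℝ≥0, 1 ≤ ⌈s / Δ⌉₊ → ⌈s / Δ⌉₊ < n →
      ∫⁻ ω, ENNReal.ofReal |lam s ω - l ⌈s / Δ⌉₊ ω| ∂Pr ≤ V ⌈s / Δ⌉₊) :
    ∫⁻ ω, ENNReal.ofReal |lam (n * Δ) ω - l n ω| ∂Pr ≤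
      L * meanMark ν b * C * ENNReal.ofReal (constR T Δ h) + L * meanMark ν b *
        ∑ k ∈ Finset.Ico 1 n, ‖h (((n - k : ℕ) : ℝ) * Δ)‖ₑ * V k * Δ := by
  have hlm := measurable_uncurry_of_predictable hlam.predictable
  have hlp := isStronglyPredictable_measurable hlam.predictable
  have hsp := measurable_step_predictable hΔ hl
  have hsm := hsp.mono (predictable_le _) le_rfl
  have hwm := measurable_binWeight h Δ n
  have hw : Measurable fun r => ‖pastWeight h (n * Δ) r - binWeight h Δ n r‖ₑ :=
    ((measurable_pastWeight hh _).sub hwm).enorm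
  have hlω : ∀ ω, Measurable fun s => lam s ω :=
    measurable_path_of_predictable hlam.predictable
  have hsω : ∀ ω, Measurable fun s : ℝ≥0 => l ⌈s / Δ⌉₊ ω := fun ω =>
    hsm.comp (f := fun s => (s, ω)) measurable_prodMk_right
  have hrep : ∀ᵐ ω ∂Pr, l n ω =
      ψ (∫ p, binWeight h Δ n p.1 * belowReal (l ⌈p.1 / Δ⌉₊ ω) p.2.1 * b p.2.2 ∂P ω) := by
    filter_upwards [ae_all_iff.2 hle, hP.ae_box_lt_top] with ω hω hbox
    rw [hω n, discIntensity_eq, ← sum_binMass_eq_integral (l := fun k => l k ω)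
      (hP.isPointMeasure ω) hbox hb hΔ n]
    simp only [hω]
  calc ∫⁻ ω, ENNReal.ofReal |lam (n * Δ) ω - l n ω| ∂Pr
      ≤ ∫⁻ ω, L * (∫⁻ p, ‖pastWeight h (n * Δ) p.1 - binWeight h Δ n p.1‖ₑ *
            below (lam p.1 ω) p.2.1 * ENNReal.ofReal (b p.2.2) ∂P ω +
          ∫⁻ p, ‖binWeight h Δ n p.1‖ₑ * between (lam p.1 ω) (l ⌈p.1 / Δ⌉₊ ω) p.2.1 *
            ENNReal.ofReal (b p.2.2) ∂P ω) ∂Pr := by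
        refine lintegral_mono_ae ?_
        filter_upwards [hlam.nonexplosive, hlam.equation, hrep, hP.ae_box_lt_top]
          with ω hfin heq hr hbox
        rw [heq _ hn, hr, setIntegral_eq_integral_pastWeight (hlω ω)]
        refine (ofReal_lipschitz_integral_le hψ
          (integrable_pastWeight (hP.isPointMeasure ω) hh hb (hlω ω) hfin hn)
          (integrable_binWeight (hP.isPointMeasure ω) hbox hb hΔ n fun k => l k ω)).trans ?_
        rw [← lintegral_add_left (measurable_markedWeight hw (hlω ω) hb)]
        gcongr with p
        exact enorm_mul_belowReal_sub_le _ _ _ _ _ (hb_nonneg _)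
    _ = L * (∫⁻ ω, ∫⁻ p, ‖pastWeight h (n * Δ) p.1 - binWeight h Δ n p.1‖ₑ *
            below (lam p.1 ω) p.2.1 * ENNReal.ofReal (b p.2.2) ∂P ω ∂Pr +
          ∫⁻ ω, ∫⁻ p, ‖binWeight h Δ n p.1‖ₑ * between (lam p.1 ω) (l ⌈p.1 / Δ⌉₊ ω) p.2.1 *
            ENNReal.ofReal (b p.2.2) ∂P ω ∂Pr) := by
        rw [lintegral_const_mul' _ _ ENNReal.coe_ne_top, lintegral_add_left']
        refine hP.aemeasurable_lintegral (H := fun ω p =>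
          ‖pastWeight h (n * Δ) p.1 - binWeight h Δ n p.1‖ₑ * below (lam p.1 ω) p.2.1 *
            ENNReal.ofReal (b p.2.2)) ?_
        have h1 : Measurable fun x : Ω × Pt => lam x.2.1 x.1 :=
          hlm.comp (f := fun x : Ω × Pt => (x.2.1, x.1)) (by fun_prop)
        have h2 : Measurable fun x : Ω × Pt => below (lam x.2.1 x.1) x.2.2.1 :=
          measurable_below h1 (by fun_prop)
        exact ((hw.comp (f := fun x : Ω × Pt => x.2.1) (by fun_prop)).mul h2).mul (by fun_prop)
    _ ≤ L * (meanMark ν b * C * ENNReal.ofReal (constR T Δ h) + meanMark ν b *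
          ∑ k ∈ Finset.Ico 1 n, ‖h (((n - k : ℕ) : ℝ) * Δ)‖ₑ * V k * Δ) := by
        gcongr
        · refine (hP.lintegral_below_intensity_le hlam hb hC hw fun r hr => ?_).trans ?_
          · have hnr : (n : ℝ≥0) * Δ < r := hn.trans_lt hr
            have h1 : ¬ (1 ≤ ⌈r / Δ⌉₊ ∧ ⌈r / Δ⌉₊ < n) := by
              rintro ⟨-, h2⟩
              have h3 : r / Δ ≤ n := (Nat.le_ceil _).trans (by exact_mod_cast h2.le)
              exact absurd ((div_le_iff₀ hΔ).1 h3) (not_le.2 hnr)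
            rw [pastWeight, if_neg (not_lt.2 hnr.le), binWeight, if_neg h1]
            simp
          · gcongr
            exact lintegral_pastWeight_sub_binWeight_le hh hint hΔ hΔT hn
        · refine (hP.lintegral_between_le (w := fun x => ‖binWeight h Δ n x.1‖ₑ)
            (l := fun x => lam x.1 x.2) (l' := fun x => l ⌈x.1 / Δ⌉₊ x.2) hb
            (hwm.enorm.comp measurable_fst_predictable) hlp hsp).trans ?_
          gcongr
          refine le_trans (lintegral_mono fun s => ?_) (lintegral_binWeight_mul_le hΔ n)
          have hd : Measurable fun ω => ENNReal.ofReal |lam s ω - l ⌈s / Δ⌉₊ ω| :=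
            ((hlm.sub hsm).comp (f := fun ω => (s, ω)) measurable_prodMk_left).abs.ennreal_ofReal
          simp only
          rw [lintegral_const_mul _ hd]
          by_cases hs : 1 ≤ ⌈s / Δ⌉₊ ∧ ⌈s / Δ⌉₊ < n
          · gcongr
            exact hV s hs.1 hs.2
          · rw [binWeight, if_neg hs]
            simp
    _ = _ := by rw [mul_add, ← mul_assoc, ← mul_assoc, ← mul_assoc]

/-- The kernel sum in the discrete stability assumption. -/
theorem sum_enorm_kernel_le {M n : ℕ} (hn : n ≤ M) :
    ∑ k ∈ Finset.Ico 1 n, ‖h (((n - k : ℕ) : ℝ) * Δ)‖ₑ ≤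
      ∑ k ∈ Finset.Icc 1 M, ‖h ((k : ℝ) * Δ)‖ₑ := by
  rw [← Finset.sum_image (g := fun k => n - k) (f := fun k : ℕ => ‖h ((k : ℝ) * Δ)‖ₑ)]
  · refine Finset.sum_le_sum_of_subset fun j hj => ?_
    obtain ⟨k, hk, rfl⟩ := Finset.mem_image.1 hj
    rw [Finset.mem_Ico] at hk
    rw [Finset.mem_Icc]
    omega
  · intro a ha b hb hab
    simp only [Finset.coe_Ico, Set.mem_Ico] at ha hb hab
    omega

/-- A discrete Gronwall argument: X = 2Y/(1 - r) solves 2Y + rX = X. Passing through λ at kΔ, the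
gap on bin k is at most Y + X, and Y + r(Y + X) ≤ 2Y + rX because r < 1. -/
theorem IsHawkesIntensity.lintegral_grid_le
    (hP : IsPoissonRandomMeasure Pr (intensityMeasure ν) P)
    (hlam : IsHawkesIntensity Pr P hP.measurable T h ψ b lam) (hψ : LipschitzWith L ψ)
    (hb_nonneg : ∀ y, 0 ≤ b y) (hb : Measurable b) (hh : Measurable h)
    (hint : IntegrableOn h (Set.Icc 0 (T : ℝ))) {C : ℝ≥0∞}
    (hC : ∀ t ≤ T, ∫⁻ ω, ENNReal.ofReal (lam t ω) ∂Pr ≤ C) (hΔ : 0 < Δ) (hΔT : Δ ≤ T)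
    (hl : ∀ n, Measurable[naturalFiltration P hP.measurable ((n - 1 : ℕ) * Δ)] (l n))
    (hle : ∀ n, ∀ᵐ ω ∂Pr, l n ω = discIntensity (P ω) h ψ b Δ n) {M : ℕ}
    (hM : (M : ℝ≥0) * Δ = T) {r : ℝ≥0∞}
    (hr : L * meanMark ν b * ((∑ k ∈ Finset.Icc 1 M, ‖h ((k : ℝ) * Δ)‖ₑ) * Δ) = r) (hr1 : r < 1)
    (n : ℕ) (hn : n ≤ M) :
    ∫⁻ ω, ENNReal.ofReal |lam (n * Δ) ω - l n ω| ∂Pr ≤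
      2 * (L * meanMark ν b * C * ENNReal.ofReal (constR T Δ h)) / (1 - r) := by
  have hlm := measurable_uncurry_of_predictable hlam.predictable
  have hlt : ∀ t, Measurable (lam t) := fun t =>
    hlm.comp (f := fun ω => (t, ω)) measurable_prodMk_left
  induction n using Nat.strong_induction_on with
  | _ n ih =>
    set Y := L * meanMark ν b * C * ENNReal.ofReal (constR T Δ h) with hY
    set X := 2 * Y / (1 - r) with hX
    have h1r : 1 - r ≠ 0 := (tsub_pos_of_lt hr1).ne'
    have h1r' : 1 - r ≠ ∞ := ENNReal.sub_ne_top ENNReal.one_ne_top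
    have hXeq : 2 * Y + r * X = X := by
      have : 2 * Y = (1 - r) * X := by rw [hX, ENNReal.mul_div_cancel h1r h1r']
      rw [this, ← add_mul, tsub_add_cancel_of_le hr1.le, one_mul]
    have hgrid : ∀ k : ℕ, k ≤ M → (k : ℝ≥0) * Δ ≤ T := fun k hk => by
      rw [← hM]; gcongr
    have hV : ∀ s : ℝ≥0, 1 ≤ ⌈s / Δ⌉₊ → ⌈s / Δ⌉₊ < n →
        ∫⁻ ω, ENNReal.ofReal |lam s ω - l ⌈s / Δ⌉₊ ω| ∂Pr ≤ Y + X := by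
      intro s hs1 hsn
      obtain ⟨k, hk⟩ : ∃ k, k = ⌈s / Δ⌉₊ := ⟨_, rfl⟩
      have hbin := (mem_bin_iff hΔ hs1 s).2 rfl
      rw [← hk] at hs1 hsn hbin ⊢
      -- Since k < n ≤ M, a full step remains before T, as the increment estimate requires.
      have hkT : (k : ℝ≥0) * Δ + Δ ≤ T := by
        have := hgrid (k + 1) (by omega)
        rwa [Nat.cast_add, Nat.cast_one, add_mul, one_mul] at this
      have hks : (k : ℝ≥0) * Δ ≤ s + Δ := by
        have : (k : ℝ≥0) * Δ = ((k - 1 : ℕ) : ℝ≥0) * Δ + Δ := by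
          obtain ⟨j, rfl⟩ : ∃ j, k = j + 1 := ⟨k - 1, by omega⟩
          rw [Nat.add_sub_cancel, Nat.cast_add, Nat.cast_one, add_mul, one_mul]
        rw [this]
        gcongr
        exact hbin.1.le
      calc ∫⁻ ω, ENNReal.ofReal |lam s ω - l k ω| ∂Pr
          ≤ ∫⁻ ω, (ENNReal.ofReal |lam (k * Δ) ω - lam s ω| +
              ENNReal.ofReal |lam (k * Δ) ω - l k ω|) ∂Pr := by
            refine lintegral_mono fun ω => ?_
            rw [← ENNReal.ofReal_add (abs_nonneg _) (abs_nonneg _), abs_sub_comm (lam (k * Δ) ω)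
              (lam s ω)]
            exact ENNReal.ofReal_le_ofReal (abs_sub_le _ _ _)
        _ = ∫⁻ ω, ENNReal.ofReal |lam (k * Δ) ω - lam s ω| ∂Pr +
              ∫⁻ ω, ENNReal.ofReal |lam (k * Δ) ω - l k ω| ∂Pr :=
            lintegral_add_left ((hlt _).sub (hlt _)).abs.ennreal_ofReal _
        _ ≤ Y + X := by
            refine add_le_add ?_ (ih k hsn (by omega))
            refine (hlam.lintegral_sub_le hP hψ hb_nonneg hb hh hC
              ((hbin.2.trans le_self_add).trans hkT) (le_self_add.trans hkT)).trans ?_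
            rw [hY]
            gcongr
            exact lintegral_pastWeight_sub_le hh hint hΔT hbin.2 hks
              ((add_le_add_left hbin.2 _).trans hkT)
    refine (hlam.lintegral_sub_disc_le hP hψ hb_nonneg hb hh hint hC hΔ hΔT hl hle
      (hgrid n hn) (V := fun _ => Y + X) hV).trans ?_
    calc Y + L * meanMark ν b * ∑ k ∈ Finset.Ico 1 n, ‖h (((n - k : ℕ) : ℝ) * Δ)‖ₑ * (Y + X) * Δ
        = Y + L * meanMark ν b * ((∑ k ∈ Finset.Ico 1 n, ‖h (((n - k : ℕ) : ℝ) * Δ)‖ₑ) * Δ) *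
            (Y + X) := by
          simp only [Finset.sum_mul, Finset.mul_sum]
          congr 1
          refine Finset.sum_congr rfl fun k _ => by ring
      _ ≤ Y + r * (Y + X) := by
          rw [← hr]
          gcongr
          exact sum_enorm_kernel_le hn
      _ = Y + r * Y + r * X := by ring
      _ ≤ Y + 1 * Y + r * X := by gcongr
      _ = X := by rw [one_mul, ← two_mul, hXeq]

end Comparison

/-! ### Real-valued constants and the final estimate -/

theorem rho_nonneg {L T : ℝ≥0} {h b : ℝ → ℝ} {ν : Measure ℝ} (hb_nonneg : ∀ y, 0 ≤ b y) :
    0 ≤ rho L T h b ν :=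
  mul_nonneg (mul_nonneg L.coe_nonneg
    (intervalIntegral.integral_nonneg T.coe_nonneg fun _ _ => abs_nonneg _))
    (integral_nonneg hb_nonneg)

theorem rhoDisc_nonneg {L Δ : ℝ≥0} {M : ℕ} {h b : ℝ → ℝ} {ν : Measure ℝ}
    (hb_nonneg : ∀ y, 0 ≤ b y) : 0 ≤ rhoDisc L Δ M h b ν :=
  mul_nonneg (mul_nonneg L.coe_nonneg (Finset.sum_nonneg fun _ _ => by positivity))
    (integral_nonneg hb_nonneg)

theorem meanMark_eq {ν : Measure ℝ} {b : ℝ → ℝ} (hb_nonneg : ∀ y, 0 ≤ b y)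
    (hb : Integrable b ν) : meanMark ν b = ENNReal.ofReal (∫ y, b y ∂ν) :=
  (ofReal_integral_eq_lintegral_ofReal hb (Filter.Eventually.of_forall hb_nonneg)).symm

theorem constR_nonneg {T Δ : ℝ≥0} {h : ℝ → ℝ} (hΔT : Δ ≤ T) : 0 ≤ constR T Δ h := by
  have h0 : (0 : ℝ) ≤ (T : ℝ) - Δ := sub_nonneg.2 hΔT
  exact add_nonneg (add_nonneg
    (intervalIntegral.integral_nonneg Δ.coe_nonneg fun _ _ => abs_nonneg _)
    (Real.iSup_nonneg fun _ => intervalIntegral.integral_nonneg h0 fun _ _ => abs_nonneg _))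
    (intervalIntegral.integral_nonneg h0 fun _ _ => abs_nonneg _)

end HawkesApprox

/-- The constant `K` may depend on `L`, `ψ`, `ν`, `b` and on an upper bound `ρ₀ < 1` for `ρ_h`,
but not on `T`, on the number `M` of steps, hence not on `Δ = T / M`, and not otherwise on `h`. -/
theorem mainTheorem7 (L : ℝ≥0) (ψ b : ℝ → ℝ) (ν : Measure ℝ) [IsProbabilityMeasure ν]
    (hψ_nonneg : ∀ x, 0 ≤ ψ x) (hψ_lip : LipschitzWith L ψ)
    (hb_nonneg : ∀ y, 0 ≤ b y) (hb_meas : Measurable b)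
    (ρ₀ : ℝ) (hρ₀ : ρ₀ < 1) :
    ∃ K : ℝ, ∀ (T : ℝ≥0) (M : ℕ) (Δ : ℝ≥0) (h : ℝ → ℝ),
      0 < T → 0 < M → Δ = T / (M : ℝ≥0) →
      Measurable h → IntegrableOn h (Set.Icc 0 (T : ℝ)) →
      HawkesApprox.Stability L T h b ν → HawkesApprox.StabilityDisc L Δ M h b ν →
      HawkesApprox.rho L T h b ν ≤ ρ₀ →
      ∀ (Ω : Type u) [MeasurableSpace Ω] (Pr : Measure Ω) [IsProbabilityMeasure Pr]
        (P : Ω → Measure HawkesApprox.Pt)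
        (hP : HawkesApprox.IsPoissonRandomMeasure Pr (HawkesApprox.intensityMeasure ν) P)
        (lam : ℝ≥0 → Ω → ℝ),
        HawkesApprox.IsHawkesIntensity Pr P hP.measurable T h ψ b lam →
        ∀ u : ℝ≥0, u ≤ T →
          Integrable (fun ω => lam (HawkesApprox.gridProj Δ u) ω
            - HawkesApprox.discLam P h ψ b Δ u ω) Pr ∧
          ∫ ω, |lam (HawkesApprox.gridProj Δ u) ω - HawkesApprox.discLam P h ψ b Δ u ω| ∂Pr
            ≤ K * (HawkesApprox.constR T Δ h * HawkesApprox.constS L T Δ M h b ν) := by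
  -- This is the factor of C_R/(1 - ρ_{h,Δ}) in 2Y/(1 - ρ_{h,Δ}), with the mean bound ψ(0)/(1 - ρ_h)
  -- replaced by ψ(0)/(1 - ρ₀).
  refine ⟨2 * (L * (∫ y, b y ∂ν) * (ψ 0 / (1 - ρ₀))), ?_⟩
  intro T M Δ h hT hM hΔ hh hint hS hSd hρ Ω _ Pr _ P hP lam hlam u hu
  obtain ⟨-, hbint, hρ1⟩ := hS
  obtain ⟨-, -, hρd⟩ := hSd
  have hM0 : (0 : ℝ≥0) < M := by exact_mod_cast hM
  have hΔ0 : 0 < Δ := hΔ ▸ div_pos hT hM0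
  have hMT : (M : ℝ≥0) * Δ = T := by rw [hΔ, mul_div_cancel₀ _ hM0.ne']
  have hΔT : Δ ≤ T := by
    rw [hΔ]; exact div_le_self zero_le (by exact_mod_cast hM)
  set n := ⌊u / Δ⌋₊ with hn
  have hnM : n ≤ M := by
    have h1 : u / Δ ≤ M := by rw [div_le_iff₀ hΔ0, hMT]; exact hu
    exact (Nat.floor_mono h1).trans_eq (Nat.floor_natCast M)
  have hE : 0 ≤ ∫ y, b y ∂ν := integral_nonneg hb_nonneg
  have hr0 := HawkesApprox.rho_nonneg (L := L) (T := T) (h := h) (ν := ν) hb_nonneg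
  have hd0 := HawkesApprox.rhoDisc_nonneg (L := L) (Δ := Δ) (M := M) (h := h) (ν := ν) hb_nonneg
  have hR0 := HawkesApprox.constR_nonneg (h := h) hΔT
  have hrho : L * HawkesApprox.meanMark ν b * ∫⁻ x, HawkesApprox.absKernel h T x =
      ENNReal.ofReal (HawkesApprox.rho L T h b ν) := by
    rw [HawkesApprox.meanMark_eq hb_nonneg hbint, HawkesApprox.lintegral_absKernel hint,
      ← ENNReal.ofReal_coe_nnreal, ← ENNReal.ofReal_mul L.coe_nonneg,
      ← ENNReal.ofReal_mul (by positivity), HawkesApprox.rho]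
    congr 1; ring
  have hrhod : L * HawkesApprox.meanMark ν b *
      ((∑ k ∈ Finset.Icc 1 M, ‖h ((k : ℝ) * Δ)‖ₑ) * Δ) =
      ENNReal.ofReal (HawkesApprox.rhoDisc L Δ M h b ν) := by
    simp only [Real.enorm_eq_ofReal_abs]
    rw [HawkesApprox.meanMark_eq hb_nonneg hbint,
      ← ENNReal.ofReal_sum_of_nonneg fun _ _ => abs_nonneg _,
      ← ENNReal.ofReal_coe_nnreal, ← ENNReal.ofReal_coe_nnreal, ← ENNReal.ofReal_mul L.coe_nonneg,
      ← ENNReal.ofReal_mul (Finset.sum_nonneg fun _ _ => abs_nonneg _),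
      ← ENNReal.ofReal_mul (by positivity), HawkesApprox.rhoDisc, Finset.sum_mul]
    congr 1; ring
  have hC := fun (t : ℝ≥0) (ht : t ≤ T) => hlam.lintegral_le hP hψ_lip hb_nonneg hb_meas hh hint
    (by rw [hrho]; exact ENNReal.ofReal_lt_one.2 hρ1) ht
  rw [hrho] at hC
  choose l hl hle using fun n => hP.exists_measurable_discIntensity (h := h) (Δ := Δ) hψ_lip
    hb_nonneg hb_meas n
  have hmain := hlam.lintegral_grid_le hP hψ_lip hb_nonneg hb_meas hh hint hC hΔ0 hΔT hl hle hMT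
    hrhod (ENNReal.ofReal_lt_one.2 hρd) n hnM
  have h1 : 0 < 1 - HawkesApprox.rho L T h b ν := by linarith
  have h2 : 0 < 1 - HawkesApprox.rhoDisc L Δ M h b ν := by linarith
  have h0 := hψ_nonneg 0
  have hX : 2 * (L * HawkesApprox.meanMark ν b * (ENNReal.ofReal (ψ 0) /
      (1 - ENNReal.ofReal (HawkesApprox.rho L T h b ν))) *
      ENNReal.ofReal (HawkesApprox.constR T Δ h)) /
      (1 - ENNReal.ofReal (HawkesApprox.rhoDisc L Δ M h b ν)) =
      ENNReal.ofReal (2 * (L * (∫ y, b y ∂ν) * (ψ 0 / (1 - HawkesApprox.rho L T h b ν)) *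
        HawkesApprox.constR T Δ h) / (1 - HawkesApprox.rhoDisc L Δ M h b ν)) := by
    rw [HawkesApprox.meanMark_eq hb_nonneg hbint, ← ENNReal.ofReal_one,
      ← ENNReal.ofReal_sub _ hr0, ← ENNReal.ofReal_sub _ hd0, ← ENNReal.ofReal_div_of_pos h1,
      ← ENNReal.ofReal_coe_nnreal, ← ENNReal.ofReal_mul L.coe_nonneg,
      ← ENNReal.ofReal_mul (by positivity), ← ENNReal.ofReal_mul (by positivity),
      ← ENNReal.ofReal_ofNat, ← ENNReal.ofReal_mul (by positivity),
      ← ENNReal.ofReal_div_of_pos h2]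
  rw [hX] at hmain
  have hcongr : (fun ω => lam (HawkesApprox.gridProj Δ u) ω
      - HawkesApprox.discLam P h ψ b Δ u ω) =ᵐ[Pr] fun ω => lam (n * Δ) ω - l n ω := by
    filter_upwards [hle n] with ω hω
    rw [hω]
    rfl
  have hmeas : Measurable fun ω => lam (n * Δ) ω - l n ω :=
    ((HawkesApprox.measurable_uncurry_of_predictable hlam.predictable).comp
      (f := fun ω => ((n : ℝ≥0) * Δ, ω)) measurable_prodMk_left).sub
      ((hl n).mono ((HawkesApprox.naturalFiltration P hP.measurable).le _) le_rfl)
  have hI : Integrable (fun ω => lam (n * Δ) ω - l n ω) Pr := by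
    refine ⟨hmeas.aestronglyMeasurable, ?_⟩
    rw [HasFiniteIntegral]
    simp only [Real.enorm_eq_ofReal_abs]
    exact hmain.trans_lt ENNReal.ofReal_lt_top
  refine ⟨hI.congr hcongr.symm, ?_⟩
  have hnn : 0 ≤ 2 * (L * (∫ y, b y ∂ν) * (ψ 0 / (1 - HawkesApprox.rho L T h b ν)) *
      HawkesApprox.constR T Δ h) / (1 - HawkesApprox.rhoDisc L Δ M h b ν) := by positivity
  -- Only the discrete summand of C_S is used; the dependence on 1/(1 - ρ_h) has been absorbed in
  -- the constant through ρ₀.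
  have hS1 : 1 / (1 - HawkesApprox.rhoDisc L Δ M h b ν) ≤ HawkesApprox.constS L T Δ M h b ν :=
    le_add_of_nonneg_left (by positivity)
  calc ∫ ω, |lam (HawkesApprox.gridProj Δ u) ω - HawkesApprox.discLam P h ψ b Δ u ω| ∂Pr
      = ∫ ω, |lam (n * Δ) ω - l n ω| ∂Pr :=
        integral_congr_ae (hcongr.mono fun ω hω => congrArg abs hω)
    _ = (∫⁻ ω, ENNReal.ofReal |lam (n * Δ) ω - l n ω| ∂Pr).toReal :=
        integral_eq_lintegral_of_nonneg_ae (Filter.Eventually.of_forall fun _ => abs_nonneg _)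
          hmeas.abs.aestronglyMeasurable
    _ ≤ 2 * (L * (∫ y, b y ∂ν) * (ψ 0 / (1 - HawkesApprox.rho L T h b ν)) *
          HawkesApprox.constR T Δ h) / (1 - HawkesApprox.rhoDisc L Δ M h b ν) :=
        ENNReal.toReal_le_of_le_ofReal hnn hmain
    _ = 2 * (L * (∫ y, b y ∂ν) * (ψ 0 / (1 - HawkesApprox.rho L T h b ν))) *
          (HawkesApprox.constR T Δ h * (1 / (1 - HawkesApprox.rhoDisc L Δ M h b ν))) := by ring
    _ ≤ 2 * (L * (∫ y, b y ∂ν) * (ψ 0 / (1 - ρ₀))) *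
          (HawkesApprox.constR T Δ h * HawkesApprox.constS L T Δ M h b ν) := by
        have hρ₀' : 0 < 1 - ρ₀ := by linarith
        gcongr
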